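/- Let $p, Q, r, s:\mathbb{R}\to\mathbb{R}$ be measurable functions such that \[ \frac{1}{\sqrt{|p|}},\ \frac{Q}{\sqrt{|p|}},\ \frac{r}{\sqrt{|p|}}\in L^2_{loc}(\mathbb{R}),\qquad s\in L^1_{loc}(\mathbb{R}),\qquad \frac1p\neq 0\ \text{ a.e.} \] Put $q=Q'+s$ (derivative in the sense of distributions) and interpret the formal differential expression $l[u]=-(pu')'+qu+i\bigl((ru)'+ru'\bigr)$ as the quasi-differential expression $l[u]:=-u^{[2]}$, where \[ u^{[1]}:=pu'-(Q+ir)u,\qquad u^{[2]}:=\bigl(u^{[1]}\bigr)'+\frac{Q-ir}{p}\,u^{[1]}+\Bigl(\frac{Q^2+r^2}{p}-s\Bigr)u . \] In the complex Hilbert space $L^2(\mathbb{R})$ let $\mathrm{L}u:=l[u]$ with domain \[ \mathrm{Dom}(\mathrm{L}):=\{u\in L^2(\mathbb{R}) : u,\,u^{[1]}\in AC_{loc}(\mathbb{R}),\ l[u]\in L^2(\mathbb{R})\}, \] and let $\mathrm{L}_{00}$ be the restriction of $\mathrm{L}$ to those $u\in\mathrm{Dom}(\mathrm{L})$ that have compact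 support. Suppose that $\mathrm{L}_{00}$ is bounded from below, i.e. there is $c\in\mathbb{R}$ with $(\mathrm{L}_{00}u,u)\ge c\,(u,u)$ for all $u\in\mathrm{Dom}(\mathrm{L}_{00})$. Suppose further that there are intervals $\Delta_n=[a_n,b_n]$, $n\in\mathbb{Z}$, with $-\infty<a_n<b_n<\infty$, $b_n\to-\infty$ as $n\to-\infty$ and $a_n\to\infty$ as $n\to\infty$, such that (i) for every $n\in\mathbb{Z}$, $p|_{\Delta_n}\in W^1_2(\Delta_n)$ and $p>0$ almost everywhere on $\Delta_n$; (ii) there is $C>0$ such that for every $n\in\mathbb{Z}$, $p(x)\le C\,|\Delta_n|^2$ for almost every $x\in\Delta_n$, where $|\Delta_n|=b_n-a_n$. (No further condition is imposed on $p$ outside the intervals $\Delta_n$; there it may vanish at some points or be discontinuous.) Then $\mathrm{L}_{00}$ is densely defined and closable, its closure is self-adjoint (that is, $\mathrm{L}_{00}$ is essentially self-adjoint), and $\mathrm{L}_{00}^*=\mathrm{L}=\mathrm{L}^*$. -/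

import Mathlib

open MeasureTheory Filter Topology
open scoped ContDiff InnerProductSpace LinearPMap

noncomputable section

namespace SturmLiouville

/-- The complex Hilbert space `L²(ℝ)`. -/
abbrev L2 : Type := Lp ℂ 2 (volume : Measure ℝ)

/-- `f ∈ L²_loc(ℝ)`: square integrable on every compact set. -/
def MemL2Loc (f : ℝ → ℝ) : Prop :=
  ∀ K : Set ℝ, IsCompact K → MemLp f 2 (volume.restrict K)

/-- `u ∈ AC_loc(ℝ)`: absolutely continuous on every compact interval. -/
def ACLoc (u : ℝ → ℂ) : Prop :=
  ∀ a b : ℝ, AbsolutelyContinuousOnInterval u a b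

/-- `f|_[a,b] ∈ W¹₂([a,b])`: `f` is in `L²(a,b)` and has a weak derivative `g` in `L²(a,b)`. -/
def MemW12 (f : ℝ → ℝ) (a b : ℝ) : Prop :=
  MemLp f 2 (volume.restrict (Set.Icc a b)) ∧
  ∃ g : ℝ → ℝ, MemLp g 2 (volume.restrict (Set.Icc a b)) ∧
    ∀ φ : ℝ → ℝ, ContDiff ℝ ∞ φ → HasCompactSupport φ → tsupport φ ⊆ Set.Ioo a b →
      ∫ x in Set.Icc a b, f x * deriv φ x = - ∫ x in Set.Icc a b, g x * φ x

/-- The standing assumptions on the real coefficients `p`, `Q`, `r`, `s` of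
`l[u] = -(p u')' + q u + i ((r u)' + r u')`, `q = Q' + s`. A real function `p` satisfies
`1 / p ≠ 0` in Lean exactly where `p ≠ 0`; in the extended sense, `p ≠ 0` almost everywhere is
forced by the local integrability of `1 / |p|`. -/
structure Admissible (p Q r s : ℝ → ℝ) : Prop where
  aemeasurable_p : AEMeasurable p volume
  ne_zero : ∀ᵐ x : ℝ, 1 / p x ≠ 0
  inv_sqrt : MemL2Loc fun x => 1 / √|p x|
  Q_div_sqrt : MemL2Loc fun x => Q x / √|p x|
  r_div_sqrt : MemL2Loc fun x => r x / √|p x|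
  s_loc : LocallyIntegrable s volume

/-- The first quasi-derivative `u^[1] = p u' - (Q + i r) u` (as an a.e. defined function). -/
def quasiDeriv₁ (p Q r : ℝ → ℝ) (u : ℝ → ℂ) (x : ℝ) : ℂ :=
  p x * deriv u x - (Q x + Complex.I * r x) * u x

/-- The second quasi-derivative
`u^[2] = (u^[1])' + (Q - i r) / p * u^[1] + ((Q² + r²) / p - s) u`,
where `v` is the absolutely continuous version of `u^[1]`. -/
def quasiDeriv₂ (p Q r s : ℝ → ℝ) (u v : ℝ → ℂ) (x : ℝ) : ℂ :=
  deriv v x + (Q x - Complex.I * r x) / p x * v x +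
    (((Q x : ℂ) ^ 2 + (r x : ℂ) ^ 2) / p x - s x) * u x

theorem ACLoc.continuous {u : ℝ → ℂ} (hu : ACLoc u) : Continuous u := by
  rw [continuous_iff_continuousAt]
  intro x
  have h := (hu (x - 1) (x + 1)).continuousOn
  rw [Set.uIcc_of_le (by linarith)] at h
  exact h.continuousAt (Icc_mem_nhds (by linarith) (by linarith))

theorem ACLoc.ae_differentiableAt {u : ℝ → ℂ} (hu : ACLoc u) :
    ∀ᵐ x : ℝ, DifferentiableAt ℝ u x := by
  have h : LocallyBoundedVariationOn u Set.univ := by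
    intro a b _ _
    rw [Set.univ_inter]
    exact (hu a b).boundedVariationOn.mono Set.Icc_subset_uIcc
  exact h.ae_differentiableAt

theorem ACLoc.add {u v : ℝ → ℂ} (hu : ACLoc u) (hv : ACLoc v) : ACLoc (u + v) :=
  fun a b => (hu a b).add (hv a b)

theorem ACLoc.smul {u : ℝ → ℂ} (c : ℂ) (hu : ACLoc u) : ACLoc (c • u) :=
  fun a b => (hu a b).const_smul c

theorem ACLoc.zero : ACLoc 0 := fun a b => by
  simpa [AbsolutelyContinuousOnInterval] using tendsto_const_nhds

/-- The graph of the maximal operator: the pairs `(f, g)` in `L²(ℝ) × L²(ℝ)` such that `f` has a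
version `u ∈ AC_loc`, `u^[1]` has a version `v ∈ AC_loc`, and `g = l[u] = -u^[2]`. -/
def maxGraph (p Q r s : ℝ → ℝ) : Submodule ℂ (L2 × L2) where
  carrier := {w | ∃ u v : ℝ → ℂ, ACLoc u ∧ ACLoc v ∧ w.1 =ᵐ[volume] u ∧
    v =ᵐ[volume] quasiDeriv₁ p Q r u ∧
    w.2 =ᵐ[volume] fun x => -quasiDeriv₂ p Q r s u v x}
  zero_mem' := by
    refine ⟨0, 0, ACLoc.zero, ACLoc.zero, Lp.coeFn_zero _ _ _, ?_, ?_⟩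
    · refine Eventually.of_forall fun x => ?_
      simp [quasiDeriv₁]
    · refine (Lp.coeFn_zero ℂ 2 volume).trans (Eventually.of_forall fun x => ?_)
      simp [quasiDeriv₂]
  add_mem' := by
    rintro ⟨f, g⟩ ⟨f', g'⟩ ⟨u, v, hu, hv, h1, h2, h3⟩ ⟨u', v', hu', hv', h1', h2', h3'⟩
    refine ⟨u + u', v + v', hu.add hu', hv.add hv', (Lp.coeFn_add f f').trans (h1.add h1'), ?_, ?_⟩
    · filter_upwards [h2, h2', hu.ae_differentiableAt, hu'.ae_differentiableAt]
        with x e e' d d'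
      simp only [Pi.add_apply, e, e', quasiDeriv₁, deriv_add d d']
      ring
    · filter_upwards [Lp.coeFn_add g g', h3, h3', hv.ae_differentiableAt, hv'.ae_differentiableAt]
        with x e0 e e' d d'
      simp only [Prod.mk_add_mk, e0, Pi.add_apply, e, e', quasiDeriv₂, deriv_add d d']
      ring
  smul_mem' := by
    rintro c ⟨f, g⟩ ⟨u, v, hu, hv, h1, h2, h3⟩
    refine ⟨c • u, c • v, hu.smul c, hv.smul c, (Lp.coeFn_smul c f).trans (h1.const_smul c), ?_, ?_⟩
    · filter_upwards [h2, hu.ae_differentiableAt] with x e d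
      simp only [Pi.smul_apply, e, quasiDeriv₁, deriv_const_smul c d, smul_eq_mul]
      ring
    · filter_upwards [Lp.coeFn_smul c g, h3, hv.ae_differentiableAt] with x e0 e d
      simp only [Prod.smul_mk, e0, Pi.smul_apply, e, quasiDeriv₂, deriv_const_smul c d,
        smul_eq_mul]
      ring

theorem maxGraph_functional (p Q r s : ℝ → ℝ) (w : L2 × L2) (hw : w ∈ maxGraph p Q r s)
    (h0 : w.1 = 0) : w.2 = 0 := by
  obtain ⟨u, v, hu, hv, h1, h2, h3⟩ := hw
  have hu0 : u = 0 := by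
    refine (hu.continuous.ae_eq_iff_eq volume continuous_zero).1 ?_
    rw [h0] at h1
    exact h1.symm.trans (Lp.coeFn_zero _ _ _)
  have hv0 : v = 0 := by
    refine (hv.continuous.ae_eq_iff_eq volume continuous_zero).1 ?_
    refine h2.trans (Eventually.of_forall fun x => ?_)
    simp [quasiDeriv₁, hu0]
  refine Lp.ext (h3.trans (EventuallyEq.trans ?_ (Lp.coeFn_zero _ _ _).symm))
  refine Eventually.of_forall fun x => ?_
  simp [quasiDeriv₂, hu0, hv0]

/-- The maximal operator `L`. -/
def maxOp (p Q r s : ℝ → ℝ) : L2 →ₗ.[ℂ] L2 := (maxGraph p Q r s).toLinearPMap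

/-- `maxGraph` is a functional graph, so it is the graph of `L`. -/
theorem graph_maxOp (p Q r s : ℝ → ℝ) : (maxOp p Q r s).graph = maxGraph p Q r s :=
  Submodule.toLinearPMap_graph_eq _ (maxGraph_functional p Q r s)

/-- The elements of `L²(ℝ)` that have a compactly supported version. -/
def compactlySupported : Submodule ℂ L2 where
  carrier := {f | ∃ u : ℝ → ℂ, HasCompactSupport u ∧ f =ᵐ[volume] u}
  zero_mem' := ⟨0, HasCompactSupport.zero, Lp.coeFn_zero _ _ _⟩
  add_mem' := by
    rintro f g ⟨u, hu, hf⟩ ⟨v, hv, hg⟩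
    exact ⟨u + v, hu.add hv, (Lp.coeFn_add f g).trans (hf.add hg)⟩
  smul_mem' := by
    rintro c f ⟨u, hu, hf⟩
    exact ⟨c • u, hu.smul_left (f := fun _ => c), (Lp.coeFn_smul c f).trans (hf.const_smul c)⟩

/-- The preminimal operator `L₀₀`: the restriction of `L` to the elements of its domain with
compact support. -/
def preminOp (p Q r s : ℝ → ℝ) : L2 →ₗ.[ℂ] L2 :=
  (maxOp p Q r s).domRestrict compactlySupported

/-- `(T u, u) ≥ c (u, u)` on the domain of `T`, for some real `c`. -/
def BoundedBelow (T : L2 →ₗ.[ℂ] L2) : Prop :=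
  ∃ c : ℝ, ∀ u : T.domain, c * ‖(u : L2)‖ ^ 2 ≤ (⟪(u : L2), T u⟫_ℂ).re

/-- `T` is densely defined and closable, and its closure is self-adjoint. -/
def EssentiallySelfAdjoint (T : L2 →ₗ.[ℂ] L2) : Prop :=
  Dense (T.domain : Set L2) ∧ T.IsClosable ∧ IsSelfAdjoint T.closure

end SturmLiouville

end

/-
Write `L` for the maximal and `L₀₀` for the preminimal operator. Lagrange's identity and the
solvability of `l[w] = h` with compactly supported `w` (for compactly supported `h` orthogonal to
the solutions of `l[y] = 0`) give `L₀₀† = L`. An operator bounded below by `c` with adjoint `L` is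
essentially self-adjoint as soon as some `λ < c` is not an eigenvalue of `L`, because the range of
its closure minus `λ` is then closed and dense.

Let `l[u] = λ u` with `u ∈ L²`. For a real cutoff `φ`, the form of `L₀₀` at `φ u` equals
`λ ∫ φ² |u|² + ∫ p φ'² |u|²`, so that `(c - λ) ∫ φ² |u|² ≤ ∫ p φ'² |u|²`. Let `φ` equal `1` between
`Δ₋ₙ` and `Δₙ`, vanish beyond them, and satisfy `|φ'| ≤ K / |Δ|` on both. As `p ≤ C |Δ|²` there, the
right-hand side is at most `C K²` times the mass of `u` on `Δ₋ₙ ∪ Δₙ`, which tends to `0`; hence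
`u = 0`.
-/

noncomputable section

namespace SturmLiouville

open scoped ComplexConjugate BoundedContinuousFunction

variable {p Q r s : ℝ → ℝ} {u v g : ℝ → ℂ}

/-! ### Absolutely continuous functions -/

section AbsolutelyContinuous

theorem absolutelyContinuousOnInterval_of_dist_le {X Y : Type*} [PseudoMetricSpace X]
    [PseudoMetricSpace Y] {f : ℝ → X} {g : ℝ → Y} {K a b : ℝ}
    (hg : AbsolutelyContinuousOnInterval g a b)
    (h : ∀ x ∈ Set.uIcc a b, ∀ y ∈ Set.uIcc a b, dist (f x) (f y) ≤ K * dist (g x) (g y)) :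
    AbsolutelyContinuousOnInterval f a b := by
  unfold AbsolutelyContinuousOnInterval at hg ⊢
  refine squeeze_zero' (Eventually.of_forall fun _ => Finset.sum_nonneg fun i _ => dist_nonneg) ?_
    (by simpa using hg.const_mul K)
  rw [eventually_inf_principal]
  filter_upwards with P hP
  rw [Finset.mul_sum]
  exact Finset.sum_le_sum fun i hi => h _ (hP.1 i hi).1 _ (hP.1 i hi).2

theorem absolutelyContinuousOnInterval_contDiff_comp {E F : Type*} [NormedAddCommGroup E]
    [NormedSpace ℝ E] [ProperSpace E] [NormedAddCommGroup F] [NormedSpace ℝ F] {f : ℝ → E}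
    {G : E → F} {a b : ℝ} (hG : ContDiff ℝ 1 G) (hf : AbsolutelyContinuousOnInterval f a b) :
    AbsolutelyContinuousOnInterval (fun x => G (f x)) a b := by
  obtain ⟨R, hR⟩ := (isCompact_uIcc.image_of_continuousOn
    hf.continuousOn).isBounded.subset_closedBall 0
  obtain ⟨K, hK⟩ := hG.contDiffOn.exists_lipschitzOnWith (by decide)
    (convex_closedBall (0 : E) R) (isCompact_closedBall 0 R)
  exact absolutelyContinuousOnInterval_of_dist_le hf fun x hx y hy =>
    hK.dist_le_mul _ (hR ⟨x, hx, rfl⟩) _ (hR ⟨y, hy, rfl⟩)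

theorem ACLoc.sub (hu : ACLoc u) (hv : ACLoc v) : ACLoc (fun x => u x - v x) :=
  fun a b => (hu a b).fun_sub (hv a b)

theorem ACLoc.mul (hu : ACLoc u) (hv : ACLoc v) : ACLoc (fun x => u x * v x) :=
  fun a b => (hu a b).fun_smul (hv a b)

theorem ACLoc.conj (hu : ACLoc u) : ACLoc (fun x => conj (u x)) := fun a b =>
  absolutelyContinuousOnInterval_contDiff_comp Complex.conjCLE.contDiff (hu a b)

theorem ACLoc.of_contDiff (hu : ContDiff ℝ 1 u) : ACLoc u :=
  fun _ _ => hu.contDiffOn.absolutelyContinuousOnInterval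

end AbsolutelyContinuous

section Primitive

variable {E : Type*} [NormedAddCommGroup E] {f g : ℝ → E}

theorem intervalIntegrable_of_locallyIntegrable (hf : LocallyIntegrable f volume) (a b : ℝ) :
    IntervalIntegrable f volume a b :=
  (hf.integrableOn_isCompact isCompact_uIcc).intervalIntegrable

theorem locallyIntegrable_norm (hf : LocallyIntegrable f volume) :
    LocallyIntegrable (fun x => ‖f x‖) volume :=
  hf.mono hf.aestronglyMeasurable.norm (by simp)

theorem locallyIntegrable_fun_add (hf : LocallyIntegrable f volume)
    (hg : LocallyIntegrable g volume) : LocallyIntegrable (fun x => f x + g x) volume :=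
  hf.add hg

variable [NormedSpace ℝ E]

theorem absolutelyContinuousOnInterval_integral (hf : LocallyIntegrable f volume) (c a b : ℝ) :
    AbsolutelyContinuousOnInterval (fun x => ∫ t in c..x, f t) a b := by
  have hint := intervalIntegrable_of_locallyIntegrable hf
  have hnorm := (intervalIntegrable_of_locallyIntegrable (locallyIntegrable_norm hf) a b
    ).absolutelyContinuousOnInterval_intervalIntegral Set.left_mem_uIcc
  refine absolutelyContinuousOnInterval_of_dist_le (K := 1) hnorm fun x _ y _ => ?_
  have hint' := intervalIntegrable_of_locallyIntegrable (locallyIntegrable_norm hf)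
  rw [one_mul, dist_eq_norm, Real.dist_eq,
    intervalIntegral.integral_interval_sub_left (hint c x) (hint c y),
    intervalIntegral.integral_interval_sub_left (hint' a x) (hint' a y)]
  exact intervalIntegral.norm_integral_le_abs_integral_norm

variable [CompleteSpace E]

theorem ae_hasDerivAt_integral (hf : LocallyIntegrable f volume) (c : ℝ) :
    ∀ᵐ x : ℝ, HasDerivAt (fun x => ∫ t in c..x, f t) (f x) x := by
  filter_upwards [LocallyIntegrable.ae_hasDerivAt_integral hf] with x hx using hx c

theorem integral_eq_sub_of_ae_hasDerivAt {a b : ℝ} (hf : AbsolutelyContinuousOnInterval f a b)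
    (hg : LocallyIntegrable g volume) (hderiv : ∀ᵐ x : ℝ, HasDerivAt f (g x) x) :
    ∫ x in a..b, g x = f b - f a := by
  obtain ⟨C, hC⟩ := (hf.fun_sub (absolutelyContinuousOnInterval_integral hg a a b)
    ).const_of_ae_hasDerivAt_zero (by
      filter_upwards [hderiv, ae_hasDerivAt_integral hg a] with x h₁ h₂ _
      simpa using h₁.fun_sub h₂)
  have ha := hC a Set.left_mem_uIcc
  have hb := hC b Set.right_mem_uIcc
  simp only [intervalIntegral.integral_same, sub_zero] at ha
  rw [ha, ← hb, sub_sub_cancel]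

theorem integral_eq_zero_of_hasCompactSupport (hf : ∀ a b, AbsolutelyContinuousOnInterval f a b)
    (hsupp : HasCompactSupport f) (hg : LocallyIntegrable g volume)
    (hderiv : ∀ᵐ x : ℝ, HasDerivAt f (g x) x) : ∫ x, g x = 0 := by
  obtain ⟨R, hR0, hR⟩ := hsupp.isBounded.subset_ball_lt 0 0
  have hzero : ∀ x, x ∉ Set.Ioo (-R) R → x ∉ tsupport f := fun x hx h =>
    hx (by simpa [Real.ball_eq_Ioo] using hR h)
  have hg0 : ∀ᵐ x : ℝ, x ∉ Set.Ioc (-R) R → g x = 0 := by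
    filter_upwards [hderiv] with x hx hxR
    have hnear := notMem_tsupport_iff_eventuallyEq.1
      (hzero x fun h => hxR (Set.Ioo_subset_Ioc_self h))
    rw [← hx.deriv, hnear.deriv_eq]
    simp
  rw [← setIntegral_eq_integral_of_ae_compl_eq_zero hg0,
    ← intervalIntegral.integral_of_le (by linarith),
    integral_eq_sub_of_ae_hasDerivAt (hf _ _) hg hderiv,
    image_eq_zero_of_notMem_tsupport (hzero R (by simp)),
    image_eq_zero_of_notMem_tsupport (hzero (-R) (by simp)), sub_zero]

end Primitive

/-! ### Linear systems with locally integrable coefficients -/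

theorem integral_comp_primitive_mul {a G : ℝ → ℝ} (hG : Continuous G)
    (ha : LocallyIntegrable a volume) (c x : ℝ) :
    ∫ t in c..x, G (∫ τ in c..t, a τ) * a t = ∫ m in (0 : ℝ)..(∫ τ in c..x, a τ), G m := by
  set M : ℝ → ℝ := fun x => ∫ τ in c..x, a τ
  have hderiv : ∀ m, HasDerivAt (fun m => ∫ s in (0 : ℝ)..m, G s) (G m) m := fun m =>
    intervalIntegral.integral_hasDerivAt_right (hG.intervalIntegrable _ _)
      hG.stronglyMeasurable.stronglyMeasurableAtFilter hG.continuousAt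
  have hsmooth : ContDiff ℝ 1 fun m => ∫ s in (0 : ℝ)..m, G s := by
    refine contDiff_one_iff_deriv.2 ⟨fun m => (hderiv m).differentiableAt, ?_⟩
    rwa [funext fun m => (hderiv m).deriv]
  have hM : Continuous M :=
    intervalIntegral.continuous_primitive (intervalIntegrable_of_locallyIntegrable ha) c
  rw [integral_eq_sub_of_ae_hasDerivAt (absolutelyContinuousOnInterval_contDiff_comp hsmooth
      (absolutelyContinuousOnInterval_integral ha c c x))
      (LocallyIntegrable.continuous_mul (g := fun t => G (M t)) (by fun_prop) ha)]
  · simp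
  · filter_upwards [ae_hasDerivAt_integral ha c] with t ht using (hderiv (M t)).comp t ht

theorem abs_integral_exp_abs_le (m : ℝ) :
    |∫ s in (0 : ℝ)..m, Real.exp (2 * |s|)| ≤ Real.exp (2 * |m|) / 2 := by
  wlog hm : 0 ≤ m generalizing m
  · have hneg := this (-m) (by linarith)
    rw [abs_neg, ← neg_zero, ← intervalIntegral.integral_comp_neg, intervalIntegral.integral_symm,
      abs_neg] at hneg
    simpa only [abs_neg] using hneg
  have hexp : ∫ s in (0 : ℝ)..m, Real.exp (2 * |s|) = ∫ s in (0 : ℝ)..m, Real.exp (2 * s) :=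
    intervalIntegral.integral_congr fun s hs => by
      simp only [abs_of_nonneg (Set.uIcc_of_le hm ▸ hs).1]
  rw [hexp, abs_of_nonneg hm, intervalIntegral.integral_comp_mul_left _ two_ne_zero, integral_exp,
    mul_zero, Real.exp_zero, smul_eq_mul, abs_of_nonneg]
  · linarith
  · have := Real.one_le_exp (by linarith : 0 ≤ 2 * m)
    linarith

section LinearSystem

variable {E : Type*} [NormedAddCommGroup E] [NormedSpace ℝ E] {A : ℝ → E →L[ℝ] E} {F y : ℝ → E}
  {a : ℝ → ℝ}

theorem locallyIntegrable_clm_apply (hA : LocallyIntegrable A volume) (hy : Continuous y) :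
    LocallyIntegrable (fun t => A t (y t)) volume := by
  refine (LocallyIntegrable.continuous_smul hy.norm (locallyIntegrable_norm hA)).mono
    ((ContinuousLinearMap.id ℝ (E →L[ℝ] E)).aestronglyMeasurable_comp₂ hA.aestronglyMeasurable
      hy.aestronglyMeasurable) (Eventually.of_forall fun x => ?_)
  simpa [mul_comm] using (A x).le_opNorm (y x)

/-- The weight `exp (2 |∫_c^x a|)`, for which the Volterra operator of a system whose coefficient
matrix is bounded by `a` has norm at most `1 / 2`. -/
def expWeight (a : ℝ → ℝ) (c x : ℝ) : ℝ := Real.exp (2 * |∫ t in c..x, a t|)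

theorem expWeight_pos (a : ℝ → ℝ) (c x : ℝ) : 0 < expWeight a c x := Real.exp_pos _

theorem one_le_expWeight (a : ℝ → ℝ) (c x : ℝ) : 1 ≤ expWeight a c x :=
  Real.one_le_exp (by positivity)

theorem continuous_expWeight (ha : LocallyIntegrable a volume) (c : ℝ) :
    Continuous (expWeight a c) := by
  have := intervalIntegral.continuous_primitive (intervalIntegrable_of_locallyIntegrable ha) c
  unfold expWeight
  fun_prop

theorem abs_integral_expWeight_mul_le (ha : LocallyIntegrable a volume) (c x : ℝ) :
    |∫ t in c..x, expWeight a c t * a t| ≤ expWeight a c x / 2 := by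
  unfold expWeight
  rw [integral_comp_primitive_mul (G := fun m => Real.exp (2 * |m|)) (by fun_prop) ha]
  exact abs_integral_exp_abs_le _

theorem norm_integral_le_expWeight (ha : LocallyIntegrable a volume) (hF : ∀ t, ‖F t‖ ≤ a t)
    (c x : ℝ) : ‖∫ t in c..x, F t‖ ≤ expWeight a c x := by
  have hexp := Real.add_one_le_exp (2 * |∫ t in c..x, a t|)
  calc ‖∫ t in c..x, F t‖ ≤ |∫ t in c..x, a t| :=
        intervalIntegral.norm_integral_le_abs_of_norm_le (Eventually.of_forall hF)
          (intervalIntegrable_of_locallyIntegrable ha _ _)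
    _ ≤ expWeight a c x := by
        unfold expWeight
        linarith [abs_nonneg (∫ t in c..x, a t)]

theorem norm_integral_clm_apply_le_expWeight (ha : LocallyIntegrable a volume)
    (hA : ∀ t, ‖A t‖ ≤ a t) {c C : ℝ} (hy : ∀ t, ‖y t‖ ≤ C * expWeight a c t) (x : ℝ) :
    ‖∫ t in c..x, A t (y t)‖ ≤ C * (expWeight a c x / 2) := by
  have hC : 0 ≤ C := nonneg_of_mul_nonneg_left ((norm_nonneg _).trans (hy 0)) (expWeight_pos a c 0)
  have hle : ∀ t, ‖A t (y t)‖ ≤ C * (expWeight a c t * a t) := fun t =>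
    calc ‖A t (y t)‖ ≤ ‖A t‖ * ‖y t‖ := (A t).le_opNorm _
      _ ≤ a t * (C * expWeight a c t) :=
        mul_le_mul (hA t) (hy t) (norm_nonneg _) ((norm_nonneg _).trans (hA t))
      _ = C * (expWeight a c t * a t) := by ring
  have hint := intervalIntegrable_of_locallyIntegrable
    (LocallyIntegrable.continuous_mul (continuous_expWeight ha c) ha) c x
  calc ‖∫ t in c..x, A t (y t)‖ ≤ |∫ t in c..x, C * (expWeight a c t * a t)| :=
        intervalIntegral.norm_integral_le_abs_of_norm_le (Eventually.of_forall hle)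
          (hint.const_mul C)
    _ = C * |∫ t in c..x, expWeight a c t * a t| := by
        rw [intervalIntegral.integral_const_mul, abs_mul, abs_of_nonneg hC]
    _ ≤ C * (expWeight a c x / 2) :=
        mul_le_mul_of_nonneg_left (abs_integral_expWeight_mul_le ha c x) hC

theorem norm_expWeight_inv_smul_le {c x C : ℝ} {e : E} (h : ‖e‖ ≤ C * expWeight a c x) :
    ‖(expWeight a c x)⁻¹ • e‖ ≤ C := by
  rwa [norm_smul, norm_inv, Real.norm_of_nonneg (expWeight_pos a c x).le,
    inv_mul_le_iff₀ (expWeight_pos a c x), mul_comm]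

theorem norm_expWeight_smul_le (c : ℝ) (z : ℝ →ᵇ E) (t : ℝ) :
    ‖expWeight a c t • z t‖ ≤ ‖z‖ * expWeight a c t := by
  rw [norm_smul, Real.norm_of_nonneg (expWeight_pos a c t).le, mul_comm]
  exact mul_le_mul_of_nonneg_right (z.norm_coe_le_norm t) (expWeight_pos a c t).le

theorem continuous_expWeight_inv_smul_primitive (ha : LocallyIntegrable a volume)
    (hF : LocallyIntegrable F volume) (c : ℝ) (e : E) :
    Continuous fun x => (expWeight a c x)⁻¹ • (e + ∫ t in c..x, F t) :=
  ((continuous_expWeight ha c).inv₀ fun x => (expWeight_pos a c x).ne').smul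
    (continuous_const.add (intervalIntegral.continuous_primitive
      (intervalIntegrable_of_locallyIntegrable hF) c))

theorem norm_expWeight_inv_smul_integral_le (ha : LocallyIntegrable a volume)
    (hAa : ∀ t, ‖A t‖ ≤ a t) (c : ℝ) (z : ℝ →ᵇ E) (x : ℝ) :
    ‖(expWeight a c x)⁻¹ • ∫ t in c..x, A t (expWeight a c t • z t)‖ ≤ 1 / 2 * ‖z‖ :=
  norm_expWeight_inv_smul_le <|
    (norm_integral_clm_apply_le_expWeight ha hAa (norm_expWeight_smul_le c z) x).trans_eq (by ring)

/-- The operator `z ↦ w⁻¹ ∫_c^x A w z` on bounded continuous functions, `w` being the weight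
`expWeight a c`: the Volterra operator of `y' = A y` after the substitution `y = w z`. -/
def weightedVolterra (hA : LocallyIntegrable A volume) (ha : LocallyIntegrable a volume)
    (hAa : ∀ t, ‖A t‖ ≤ a t) (c : ℝ) : (ℝ →ᵇ E) →L[ℝ] (ℝ →ᵇ E) :=
  have hint (z : ℝ →ᵇ E) : LocallyIntegrable (fun t => A t (expWeight a c t • z t)) volume :=
    locallyIntegrable_clm_apply hA ((continuous_expWeight ha c).smul z.continuous)
  LinearMap.mkContinuous
    { toFun := fun z => .ofNormedAddCommGroup
        (fun x => (expWeight a c x)⁻¹ • ∫ t in c..x, A t (expWeight a c t • z t))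
        (by simpa using continuous_expWeight_inv_smul_primitive ha (hint z) c 0) _
        (norm_expWeight_inv_smul_integral_le ha hAa c z)
      map_add' := fun z z' => by
        ext x
        have hadd := intervalIntegral.integral_add
          (intervalIntegrable_of_locallyIntegrable (hint z) c x)
          (intervalIntegrable_of_locallyIntegrable (hint z') c x)
        simp only [map_smul] at hadd
        simp [hadd]
      map_smul' := fun k z => by
        ext x
        simp [smul_comm _ k] }
    (1 / 2) fun z => BoundedContinuousFunction.norm_le (by positivity) |>.2
      (norm_expWeight_inv_smul_integral_le ha hAa c z)

theorem weightedVolterra_apply (hA : LocallyIntegrable A volume) (ha : LocallyIntegrable a volume)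
    (hAa : ∀ t, ‖A t‖ ≤ a t) (c : ℝ) (z : ℝ →ᵇ E) (x : ℝ) :
    weightedVolterra hA ha hAa c z x =
      (expWeight a c x)⁻¹ • ∫ t in c..x, A t (expWeight a c t • z t) :=
  rfl

theorem norm_weightedVolterra_le (hA : LocallyIntegrable A volume)
    (ha : LocallyIntegrable a volume) (hAa : ∀ t, ‖A t‖ ≤ a t) (c : ℝ) :
    ‖weightedVolterra hA ha hAa c‖ ≤ 1 / 2 :=
  ContinuousLinearMap.opNorm_le_bound _ (by norm_num) fun z =>
    (BoundedContinuousFunction.norm_le (by positivity)).2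
      (norm_expWeight_inv_smul_integral_le ha hAa c z)

variable [CompleteSpace E]

theorem exists_eq_add_apply_of_norm_lt_one {T : E →L[ℝ] E} (hT : ‖T‖ < 1) (e : E) :
    ∃ z, z = e + T z := by
  obtain ⟨S, hS⟩ := isUnit_one_sub_of_norm_lt_one hT
  refine ⟨(↑S⁻¹ : E →L[ℝ] E) e, ?_⟩
  have h : (1 - T) ((↑S⁻¹ : E →L[ℝ] E) e) = e := by
    rw [← hS]
    exact DFunLike.congr_fun (Units.mul_inv S) e
  simpa [sub_eq_iff_eq_add] using h

theorem exists_integral_eq (hA : LocallyIntegrable A volume) (hF : LocallyIntegrable F volume)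
    (c : ℝ) (y₀ : E) :
    ∃ y : ℝ → E, Continuous y ∧ ∀ x, y x = y₀ + ∫ t in c..x, (A t (y t) + F t) := by
  set a : ℝ → ℝ := fun t => ‖A t‖ + ‖F t‖
  have ha : LocallyIntegrable a volume :=
    (locallyIntegrable_norm hA).add (locallyIntegrable_norm hF)
  have hAa : ∀ t, ‖A t‖ ≤ a t := fun t => le_add_of_nonneg_right (norm_nonneg _)
  have hFa : ∀ t, ‖F t‖ ≤ a t := fun t => le_add_of_nonneg_left (norm_nonneg _)
  have hbound : ∀ x, ‖(expWeight a c x)⁻¹ • (y₀ + ∫ t in c..x, F t)‖ ≤ ‖y₀‖ + 1 := fun x => by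
    refine norm_expWeight_inv_smul_le ((norm_add_le _ _).trans ?_)
    have := norm_integral_le_expWeight ha hFa c x
    nlinarith [one_le_expWeight a c x, norm_nonneg y₀]
  let b : ℝ →ᵇ E := .ofNormedAddCommGroup _ (continuous_expWeight_inv_smul_primitive ha hF c y₀) _
    hbound
  obtain ⟨z, hz⟩ := exists_eq_add_apply_of_norm_lt_one
    ((norm_weightedVolterra_le hA ha hAa c).trans_lt (by norm_num)) b
  have hcont : Continuous fun x => expWeight a c x • z x :=
    (continuous_expWeight ha c).smul z.continuous
  refine ⟨fun x => expWeight a c x • z x, hcont, fun x => ?_⟩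
  have hzx : z x = (expWeight a c x)⁻¹ • (y₀ + ∫ t in c..x, F t) +
      (expWeight a c x)⁻¹ • ∫ t in c..x, A t (expWeight a c t • z t) := by
    conv_lhs => rw [hz]
    rw [BoundedContinuousFunction.add_apply, weightedVolterra_apply]
    rfl
  have hint := intervalIntegrable_of_locallyIntegrable (locallyIntegrable_clm_apply hA hcont) c x
  beta_reduce
  rw [intervalIntegral.integral_add hint (intervalIntegrable_of_locallyIntegrable hF c x), hzx,
    ← smul_add, smul_inv_smul₀ (expWeight_pos a c x).ne']
  abel

end LinearSystem

/-! ### Quasi-solutions -/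

section Coefficients

theorem locallyIntegrable_ofReal {f : ℝ → ℝ} (hf : LocallyIntegrable f volume) :
    LocallyIntegrable (fun x => (f x : ℂ)) volume :=
  hf.mono (Complex.continuous_ofReal.comp_aestronglyMeasurable hf.aestronglyMeasurable) (by simp)

theorem MemL2Loc.locallyIntegrable_mul {f g : ℝ → ℝ} (hf : MemL2Loc f) (hg : MemL2Loc g) :
    LocallyIntegrable (fun x => f x * g x) volume :=
  locallyIntegrable_iff.2 fun K hK => (hf K hK).integrable_mul (hg K hK)

theorem MemL2Loc.aestronglyMeasurable {f : ℝ → ℝ} (hf : MemL2Loc f) :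
    AEStronglyMeasurable f volume := by
  refine LocallyIntegrable.aestronglyMeasurable (locallyIntegrable_iff.2 fun K hK => ?_)
  have : IsFiniteMeasure (volume.restrict K) := ⟨by simpa using hK.measure_lt_top⟩
  exact (hf K hK).integrable (by norm_num)

theorem Admissible.p_ne_zero (hc : Admissible p Q r s) : ∀ᵐ x : ℝ, p x ≠ 0 := by
  filter_upwards [hc.ne_zero] with x hx
  simpa using hx

theorem Admissible.aestronglyMeasurable_of_div_sqrt (hc : Admissible p Q r s) {f : ℝ → ℝ}
    (hf : MemL2Loc fun x => f x / √|p x|) : AEStronglyMeasurable f volume := by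
  have hmul : AEMeasurable (fun x => f x / √|p x| * √|p x|) volume :=
    hf.aestronglyMeasurable.aemeasurable.mul hc.aemeasurable_p.abs.sqrt
  refine (hmul.congr ?_).aestronglyMeasurable
  filter_upwards [hc.p_ne_zero] with x hx
  exact div_mul_cancel₀ _ (Real.sqrt_pos.2 (abs_pos.2 hx)).ne'

theorem Admissible.locallyIntegrable_mul_div (hc : Admissible p Q r s) {f g : ℝ → ℝ}
    (hf : MemL2Loc fun x => f x / √|p x|) (hg : MemL2Loc fun x => g x / √|p x|) :
    LocallyIntegrable (fun x => ((f x * g x / p x : ℝ) : ℂ)) volume := by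
  refine locallyIntegrable_ofReal <|
    (hf.locallyIntegrable_mul hg).mono ?_ (Eventually.of_forall fun x => le_of_eq ?_)
  · exact (((hc.aestronglyMeasurable_of_div_sqrt hf).aemeasurable.mul
      (hc.aestronglyMeasurable_of_div_sqrt hg).aemeasurable).div
        hc.aemeasurable_p).aestronglyMeasurable
  · rw [div_mul_div_comm, Real.mul_self_sqrt (abs_nonneg _), norm_div, norm_div,
      Real.norm_eq_abs |p x|, abs_abs, Real.norm_eq_abs (p x)]

/-- The matrix `A` of the first-order system `(u, v)' = A (u, v) + (0, -g)` equivalent to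
`l[u] = g`, `v = u^[1]`. The factors `1` give every quotient by `p` the form `f g / p` with
`f / √|p|`, `g / √|p|` in `L²_loc`. -/
def systemMatrix (p Q r s : ℝ → ℝ) (x : ℝ) : (ℂ × ℂ) →L[ℝ] (ℂ × ℂ) :=
  let π₁ := ContinuousLinearMap.fst ℝ ℂ ℂ
  let π₂ := ContinuousLinearMap.snd ℝ ℂ ℂ
  (((Q x * 1 / p x : ℝ) : ℂ) + Complex.I • ((r x * 1 / p x : ℝ) : ℂ)) • (.inl ℝ ℂ ℂ ∘L π₁) +
    ((1 * 1 / p x : ℝ) : ℂ) • (.inl ℝ ℂ ℂ ∘L π₂) +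
    ((s x : ℂ) - ((Q x * Q x / p x : ℝ) : ℂ) - ((r x * r x / p x : ℝ) : ℂ)) •
      (.inr ℝ ℂ ℂ ∘L π₁) +
    (Complex.I • ((r x * 1 / p x : ℝ) : ℂ) - ((Q x * 1 / p x : ℝ) : ℂ)) • (.inr ℝ ℂ ℂ ∘L π₂)

theorem systemMatrix_apply (x : ℝ) (y : ℂ × ℂ) :
    systemMatrix p Q r s x y =
      ((y.2 + (Q x + Complex.I * r x) * y.1) / p x,
        -((Q x - Complex.I * r x) / p x * y.2) -
          (((Q x : ℂ) ^ 2 + (r x : ℂ) ^ 2) / p x - s x) * y.1) := by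
  simp only [systemMatrix, add_apply, smul_apply,
    ContinuousLinearMap.comp_apply, ContinuousLinearMap.coe_fst', ContinuousLinearMap.coe_snd',
    ContinuousLinearMap.inl_apply, ContinuousLinearMap.inr_apply]
  ext <;> simp <;> ring

theorem Admissible.locallyIntegrable_systemMatrix (hc : Admissible p Q r s) :
    LocallyIntegrable (systemMatrix p Q r s) volume := by
  have hp := hc.locallyIntegrable_mul_div hc.inv_sqrt hc.inv_sqrt
  have hQ := hc.locallyIntegrable_mul_div hc.Q_div_sqrt hc.inv_sqrt
  have hr := (hc.locallyIntegrable_mul_div hc.r_div_sqrt hc.inv_sqrt).smul Complex.I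
  have hQQ := hc.locallyIntegrable_mul_div hc.Q_div_sqrt hc.Q_div_sqrt
  have hrr := hc.locallyIntegrable_mul_div hc.r_div_sqrt hc.r_div_sqrt
  have hs := locallyIntegrable_ofReal hc.s_loc
  have hsmul {k : ℝ → ℂ} (hk : LocallyIntegrable k volume) (T : (ℂ × ℂ) →L[ℝ] (ℂ × ℂ)) :
      LocallyIntegrable (fun x => k x • T) volume :=
    LocallyIntegrable.smul_continuous continuous_const hk
  exact locallyIntegrable_fun_add (locallyIntegrable_fun_add (locallyIntegrable_fun_add
    (hsmul (hQ.add hr) _) (hsmul hp _)) (hsmul ((hs.sub hQQ).sub hrr) _)) (hsmul (hr.sub hQ) _)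

end Coefficients

/-- `u` solves `l[u] = g`, and `v` is the absolutely continuous version of `u^[1]`. -/
structure IsQuasiSolution (p Q r s : ℝ → ℝ) (u v g : ℝ → ℂ) : Prop where
  ac : ACLoc u
  ac_quasiDeriv : ACLoc v
  quasiDeriv_eq : v =ᵐ[volume] quasiDeriv₁ p Q r u
  eq : g =ᵐ[volume] fun x => -quasiDeriv₂ p Q r s u v x

theorem mem_maxGraph_iff {w : L2 × L2} :
    w ∈ maxGraph p Q r s ↔ ∃ u v, w.1 =ᵐ[volume] u ∧ IsQuasiSolution p Q r s u v w.2 :=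
  ⟨fun ⟨u, v, hu, hv, h1, h2, h3⟩ => ⟨u, v, h1, hu, hv, h2, h3⟩,
    fun ⟨u, v, h1, hu, hv, h2, h3⟩ => ⟨u, v, hu, hv, h1, h2, h3⟩⟩

theorem IsQuasiSolution.congr {g' : ℝ → ℂ} (h : IsQuasiSolution p Q r s u v g)
    (hg : g' =ᵐ[volume] g) : IsQuasiSolution p Q r s u v g' :=
  ⟨h.ac, h.ac_quasiDeriv, h.quasiDeriv_eq, hg.trans h.eq⟩

theorem IsQuasiSolution.add {u' v' g' : ℝ → ℂ} (h : IsQuasiSolution p Q r s u v g)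
    (h' : IsQuasiSolution p Q r s u' v' g') :
    IsQuasiSolution p Q r s (u + u') (v + v') (g + g') := by
  refine ⟨h.ac.add h'.ac, h.ac_quasiDeriv.add h'.ac_quasiDeriv, ?_, ?_⟩
  · filter_upwards [h.quasiDeriv_eq, h'.quasiDeriv_eq, h.ac.ae_differentiableAt,
      h'.ac.ae_differentiableAt] with x e e' d d'
    simp only [Pi.add_apply, e, e', quasiDeriv₁, deriv_add d d']
    ring
  · filter_upwards [h.eq, h'.eq, h.ac_quasiDeriv.ae_differentiableAt,
      h'.ac_quasiDeriv.ae_differentiableAt] with x e e' d d'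
    simp only [Pi.add_apply, e, e', quasiDeriv₂, deriv_add d d']
    ring

theorem IsQuasiSolution.smul (c : ℂ) (h : IsQuasiSolution p Q r s u v g) :
    IsQuasiSolution p Q r s (c • u) (c • v) (c • g) := by
  refine ⟨h.ac.smul c, h.ac_quasiDeriv.smul c, ?_, ?_⟩
  · filter_upwards [h.quasiDeriv_eq, h.ac.ae_differentiableAt] with x e d
    simp only [Pi.smul_apply, e, quasiDeriv₁, deriv_const_smul c d, smul_eq_mul]
    ring
  · filter_upwards [h.eq, h.ac_quasiDeriv.ae_differentiableAt] with x e d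
    simp only [Pi.smul_apply, e, quasiDeriv₂, deriv_const_smul c d, smul_eq_mul]
    ring

theorem isQuasiSolution_of_ae_hasDerivAt (hp : ∀ᵐ x : ℝ, p x ≠ 0) (hu : ACLoc u) (hv : ACLoc v)
    (hderiv : ∀ᵐ x : ℝ, HasDerivAt (fun x => (u x, v x))
      (systemMatrix p Q r s x (u x, v x) + (0, -g x)) x) :
    IsQuasiSolution p Q r s u v g := by
  refine ⟨hu, hv, ?_, ?_⟩
  · filter_upwards [hderiv, hp] with x hx hpx
    have hpx' : (p x : ℂ) ≠ 0 := by exact_mod_cast hpx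
    rw [quasiDeriv₁, hx.hasFDerivAt.fst.hasDerivAt.deriv, systemMatrix_apply]
    simp only [ContinuousLinearMap.comp_apply, ContinuousLinearMap.toSpanSingleton_apply, one_smul,
      ContinuousLinearMap.coe_fst', Prod.fst_add, add_zero]
    field_simp
    ring
  · filter_upwards [hderiv] with x hx
    rw [quasiDeriv₂, hx.hasFDerivAt.snd.hasDerivAt.deriv, systemMatrix_apply]
    simp only [ContinuousLinearMap.comp_apply, ContinuousLinearMap.toSpanSingleton_apply, one_smul,
      ContinuousLinearMap.coe_snd', Prod.snd_add]
    ring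

theorem Admissible.exists_isQuasiSolution (hc : Admissible p Q r s)
    (hg : LocallyIntegrable g volume) (c : ℝ) (α β : ℂ) :
    ∃ u v, IsQuasiSolution p Q r s u v g ∧ u c = α ∧ v c = β := by
  have hA := hc.locallyIntegrable_systemMatrix
  have hF : LocallyIntegrable (fun x => ((0 : ℂ), -g x)) volume :=
    hg.mono (aestronglyMeasurable_const.prodMk hg.aestronglyMeasurable.neg) (by simp)
  obtain ⟨y, hyc, hy⟩ := exists_integral_eq hA hF c (α, β)
  have hloc := (locallyIntegrable_clm_apply hA hyc).add hF
  have hac (a b : ℝ) : AbsolutelyContinuousOnInterval y a b :=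
    absolutelyContinuousOnInterval_of_dist_le (K := 1)
      (absolutelyContinuousOnInterval_integral hloc c a b) fun x _ x' _ => by
        rw [hy x, hy x', dist_add_left, one_mul]
        rfl
  have hderiv : ∀ᵐ x : ℝ, HasDerivAt (fun x => ((y x).1, (y x).2))
      (systemMatrix p Q r s x ((y x).1, (y x).2) + (0, -g x)) x := by
    filter_upwards [ae_hasDerivAt_integral hloc c] with x hx
    exact (hx.const_add (α, β)).congr_of_eventuallyEq (Eventually.of_forall hy)
  refine ⟨fun x => (y x).1, fun x => (y x).2, isQuasiSolution_of_ae_hasDerivAt hc.p_ne_zero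
    (fun a b => ?_) (fun a b => ?_) hderiv, by simp [hy c], by simp [hy c]⟩
  · exact absolutelyContinuousOnInterval_contDiff_comp contDiff_fst (hac a b)
  · exact absolutelyContinuousOnInterval_contDiff_comp contDiff_snd (hac a b)

section Lagrange

variable {y z h : ℝ → ℂ}

theorem IsQuasiSolution.ae_hasDerivAt (hu : IsQuasiSolution p Q r s u v g)
    (hp : ∀ᵐ x : ℝ, p x ≠ 0) :
    ∀ᵐ x : ℝ, HasDerivAt u ((v x + (Q x + Complex.I * r x) * u x) / p x) x := by
  filter_upwards [hu.quasiDeriv_eq, hu.ac.ae_differentiableAt, hp] with x hx hd hpx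
  have hpx' : (p x : ℂ) ≠ 0 := by exact_mod_cast hpx
  refine hd.hasDerivAt.congr_deriv ?_
  rw [hx, quasiDeriv₁]
  field_simp
  ring

theorem IsQuasiSolution.ae_hasDerivAt_quasiDeriv (hu : IsQuasiSolution p Q r s u v g) :
    ∀ᵐ x : ℝ, HasDerivAt v (-g x - (Q x - Complex.I * r x) / p x * v x -
      (((Q x : ℂ) ^ 2 + (r x : ℂ) ^ 2) / p x - s x) * u x) x := by
  filter_upwards [hu.eq, hu.ac_quasiDeriv.ae_differentiableAt] with x hx hd
  refine hd.hasDerivAt.congr_deriv ?_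
  rw [hx, quasiDeriv₂]
  ring

/-- The Lagrange bracket `u^[1] ȳ - u z̄` of `u` and `y`, where `v = u^[1]` and `z = y^[1]`. -/
def bracket (u v y z : ℝ → ℂ) (x : ℝ) : ℂ := v x * conj (y x) - u x * conj (z x)

theorem IsQuasiSolution.ac_bracket (hu : IsQuasiSolution p Q r s u v g)
    (hy : IsQuasiSolution p Q r s y z h) : ACLoc (bracket u v y z) :=
  (hu.ac_quasiDeriv.mul hy.ac.conj).sub (hu.ac.mul hy.ac_quasiDeriv.conj)

theorem IsQuasiSolution.ae_hasDerivAt_bracket (hu : IsQuasiSolution p Q r s u v g)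
    (hy : IsQuasiSolution p Q r s y z h) (hp : ∀ᵐ x : ℝ, p x ≠ 0) :
    ∀ᵐ x : ℝ, HasDerivAt (bracket u v y z) (u x * conj (h x) - g x * conj (y x)) x := by
  filter_upwards [hu.ae_hasDerivAt hp, hy.ae_hasDerivAt hp, hu.ae_hasDerivAt_quasiDeriv,
    hy.ae_hasDerivAt_quasiDeriv] with x hu' hy' hv' hz'
  refine ((hv'.mul hy'.star).sub (hu'.mul hz'.star)).congr_deriv ?_
  simp only [Complex.star_def, map_sub, map_add, map_mul, map_div₀, map_neg, map_pow,
    Complex.conj_ofReal, Complex.conj_I]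
  ring

theorem locallyIntegrable_conj (hg : LocallyIntegrable g volume) :
    LocallyIntegrable (fun x => conj (g x)) volume :=
  hg.mono (Complex.continuous_conj.comp_aestronglyMeasurable hg.aestronglyMeasurable) (by simp)

theorem locallyIntegrable_mul_conj_sub (hu : Continuous u) (hh : LocallyIntegrable h volume)
    (hy : Continuous y) (hg : LocallyIntegrable g volume) :
    LocallyIntegrable (fun x => u x * conj (h x) - g x * conj (y x)) volume :=
  (LocallyIntegrable.continuous_mul hu (locallyIntegrable_conj hh)).sub
    (LocallyIntegrable.mul_continuous (Complex.continuous_conj.comp hy) hg)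

theorem IsQuasiSolution.bracket_sub_bracket (hu : IsQuasiSolution p Q r s u v g)
    (hy : IsQuasiSolution p Q r s y z h) (hp : ∀ᵐ x : ℝ, p x ≠ 0)
    (hg : LocallyIntegrable g volume) (hh : LocallyIntegrable h volume) (a b : ℝ) :
    bracket u v y z b - bracket u v y z a = ∫ x in a..b, (u x * conj (h x) - g x * conj (y x)) :=
  (integral_eq_sub_of_ae_hasDerivAt (hu.ac_bracket hy a b)
    (locallyIntegrable_mul_conj_sub hu.ac.continuous hh hy.ac.continuous hg)
    (hu.ae_hasDerivAt_bracket hy hp)).symm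

end Lagrange

section CompactSupport

variable {y z h : ℝ → ℂ}

theorem intervalIntegral_eq_zero_of_notMem {E : Type*} [NormedAddCommGroup E] [NormedSpace ℝ E]
    {F : ℝ → E} {a b x : ℝ} (hF : ∀ t ∉ Set.Icc a b, F t = 0) (h0 : ∫ t, F t = 0)
    (hx : x ∉ Set.Icc a b) : ∫ t in a..x, F t = 0 := by
  rcases lt_or_ge x a with hlt | hle
  · rw [intervalIntegral.integral_symm, intervalIntegral.integral_of_le hlt.le,
      integral_Ioc_eq_integral_Ioo,
      setIntegral_eq_zero_of_forall_eq_zero fun t ht => hF t fun h => by linarith [ht.2, h.1],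
      neg_zero]
  · have hbx : b < x := lt_of_not_ge fun h => hx ⟨hle, h⟩
    rw [intervalIntegral.integral_of_le hle, ← integral_Icc_eq_integral_Ioc,
      setIntegral_eq_integral_of_forall_compl_eq_zero
        fun t ht => hF t fun h => ht (Set.Icc_subset_Icc_right hbx.le h), h0]

theorem tsupport_subset_of_ae {E : Type*} [NormedAddCommGroup E] {f : ℝ → E} {K : Set ℝ}
    (hf : Continuous f) (hK : IsClosed K) (h0 : ∀ᵐ x : ℝ, x ∉ K → f x = 0) : tsupport f ⊆ K := by
  have hzero : Set.EqOn f 0 Kᶜ := Measure.eqOn_open_of_ae_eq (μ := volume)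
    ((ae_restrict_iff' hK.measurableSet.compl).2 h0) hK.isOpen_compl hf.continuousOn
    continuousOn_const
  exact closure_minimal (fun x hx => by_contra fun hxK => hx (hzero hxK)) hK

theorem IsQuasiSolution.tsupport_quasiDeriv_subset (hu : IsQuasiSolution p Q r s u v g) :
    tsupport v ⊆ tsupport u := by
  refine tsupport_subset_of_ae hu.ac_quasiDeriv.continuous (isClosed_tsupport u) ?_
  filter_upwards [hu.quasiDeriv_eq] with x hx hxu
  have hd : deriv u x = 0 := image_eq_zero_of_notMem_tsupport
    fun h => hxu (tsupport_deriv_subset h)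
  rw [hx, quasiDeriv₁, hd, image_eq_zero_of_notMem_tsupport hxu, mul_zero, mul_zero, sub_zero]

theorem IsQuasiSolution.quasiDeriv_eq_zero (hu : IsQuasiSolution p Q r s u v g) {x : ℝ}
    (hx : x ∉ tsupport u) : v x = 0 :=
  image_eq_zero_of_notMem_tsupport fun h => hx (hu.tsupport_quasiDeriv_subset h)

theorem IsQuasiSolution.ae_eq_zero (hu : IsQuasiSolution p Q r s u v g) :
    ∀ᵐ x : ℝ, x ∉ tsupport u → g x = 0 := by
  filter_upwards [hu.eq] with x hx hxu
  have hd : deriv v x = 0 := image_eq_zero_of_notMem_tsupport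
    fun h => hxu (hu.tsupport_quasiDeriv_subset (tsupport_deriv_subset h))
  rw [hx, quasiDeriv₂, hd, hu.quasiDeriv_eq_zero hxu,
    image_eq_zero_of_notMem_tsupport hxu, mul_zero, mul_zero, add_zero, add_zero, neg_zero]

theorem IsQuasiSolution.integral_mul_conj_eq (hu : IsQuasiSolution p Q r s u v g)
    (hy : IsQuasiSolution p Q r s y z h) (hp : ∀ᵐ x : ℝ, p x ≠ 0)
    (hg : LocallyIntegrable g volume) (hh : LocallyIntegrable h volume)
    (hsupp : HasCompactSupport u) :
    ∫ x, u x * conj (h x) = ∫ x, g x * conj (y x) := by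
  have hbracket : HasCompactSupport (bracket u v y z) := HasCompactSupport.intro hsupp
    fun x hx => by
      rw [bracket, hu.quasiDeriv_eq_zero hx, image_eq_zero_of_notMem_tsupport hx, zero_mul,
        zero_mul, sub_zero]
  have hint := integral_eq_zero_of_hasCompactSupport (hu.ac_bracket hy) hbracket
    (locallyIntegrable_mul_conj_sub hu.ac.continuous hh hy.ac.continuous hg)
    (hu.ae_hasDerivAt_bracket hy hp)
  have huh : Integrable (fun x => u x * conj (h x)) volume :=
    IntegrableOn.integrable_of_ae_notMem_eq_zero
      ((LocallyIntegrable.continuous_mul hu.ac.continuous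
        (locallyIntegrable_conj hh)).integrableOn_isCompact hsupp)
      (Eventually.of_forall fun x hx => by rw [image_eq_zero_of_notMem_tsupport hx, zero_mul])
  have hgy : Integrable (fun x => g x * conj (y x)) volume := by
    refine IntegrableOn.integrable_of_ae_notMem_eq_zero
      ((LocallyIntegrable.mul_continuous (Complex.continuous_conj.comp hy.ac.continuous)
        hg).integrableOn_isCompact hsupp) ?_
    filter_upwards [hu.ae_eq_zero] with x hx hxu
    rw [hx hxu, zero_mul]
  rwa [integral_sub huh hgy, sub_eq_zero] at hint

theorem Admissible.exists_fundamental (hc : Admissible p Q r s) :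
    ∃ y z : Fin 2 → ℝ → ℂ, (∀ i, IsQuasiSolution p Q r s (y i) (z i) 0) ∧
      ∀ u v x, (∀ i, bracket u v (y i) (z i) x = 0) → u x = 0 ∧ v x = 0 := by
  have hzero : LocallyIntegrable (0 : ℝ → ℂ) volume := locallyIntegrable_zero
  obtain ⟨y₁, z₁, h₁, hy₁, hz₁⟩ := hc.exists_isQuasiSolution hzero 0 1 0
  obtain ⟨y₂, z₂, h₂, hy₂, hz₂⟩ := hc.exists_isQuasiSolution hzero 0 0 1
  refine ⟨![y₁, y₂], ![z₁, z₂], Fin.forall_fin_two.2 ⟨h₁, h₂⟩, fun u v x hbr => ?_⟩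
  obtain ⟨e₁, e₂⟩ : bracket u v y₁ z₁ x = 0 ∧ bracket u v y₂ z₂ x = 0 := ⟨hbr 0, hbr 1⟩
  have k₁₁ := h₁.bracket_sub_bracket h₁ hc.p_ne_zero hzero hzero 0 x
  have k₁₂ := h₁.bracket_sub_bracket h₂ hc.p_ne_zero hzero hzero 0 x
  have k₂₁ := h₂.bracket_sub_bracket h₁ hc.p_ne_zero hzero hzero 0 x
  simp only [bracket, hy₁, hz₁, hy₂, hz₂, Pi.zero_apply, map_zero, map_one, mul_zero, zero_mul,
    mul_one, sub_zero, zero_sub, sub_neg_eq_add, intervalIntegral.integral_zero]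
    at k₁₁ k₁₂ k₂₁ e₁ e₂
  have hwronskian : (y₁ x * z₂ x - z₁ x * y₂ x) *
      (conj (y₁ x) * conj (z₂ x) - conj (z₁ x) * conj (y₂ x)) = 1 := by
    linear_combination (z₂ x * conj (y₂ x) - y₂ x * conj (z₂ x)) * k₁₁ -
      (z₂ x * conj (y₁ x) - y₂ x * conj (z₁ x)) * k₁₂ + k₂₁
  have hne := right_ne_zero_of_mul_eq_one hwronskian
  constructor
  · refine (mul_eq_zero_iff_right hne).1 ?_
    linear_combination conj (y₂ x) * e₁ - conj (y₁ x) * e₂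
  · refine (mul_eq_zero_iff_right hne).1 ?_
    linear_combination conj (z₂ x) * e₁ - conj (z₁ x) * e₂

theorem Admissible.exists_isQuasiSolution_hasCompactSupport (hc : Admissible p Q r s)
    {ι : Type*} {y z : ι → ℝ → ℂ} (hy : ∀ i, IsQuasiSolution p Q r s (y i) (z i) 0)
    (hnondeg : ∀ u v x, (∀ i, bracket u v (y i) (z i) x = 0) → u x = 0 ∧ v x = 0)
    (hh : LocallyIntegrable h volume) (hsupp : HasCompactSupport h)
    (horth : ∀ i, ∫ x, h x * conj (y i x) = 0) :
    ∃ u v, IsQuasiSolution p Q r s u v h ∧ HasCompactSupport u := by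
  obtain ⟨R, hR⟩ := hsupp.isCompact.isBounded.subset_closedBall 0
  rw [Real.closedBall_eq_Icc] at hR
  set I := Set.Icc (0 - R) (0 + R)
  obtain ⟨u, v, hu, hua, hva⟩ := hc.exists_isQuasiSolution hh (0 - R) 0 0
  refine ⟨u, v, hu, HasCompactSupport.intro (K := I) isCompact_Icc fun x hx =>
    (hnondeg u v x fun i => ?_).1⟩
  have hF : ∀ t ∉ I, h t * conj (y i t) = 0 := fun t ht => by
    rw [image_eq_zero_of_notMem_tsupport fun h => ht (hR h), zero_mul]
  have hbr := hu.bracket_sub_bracket (hy i) hc.p_ne_zero hh locallyIntegrable_zero (0 - R) x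
  simp only [Pi.zero_apply, map_zero, mul_zero, zero_sub (_ * _), intervalIntegral.integral_neg,
    intervalIntegral_eq_zero_of_notMem hF (horth i) hx, neg_zero] at hbr
  rw [sub_eq_zero.1 hbr, bracket, hua, hva, zero_mul, zero_mul, sub_zero]

end CompactSupport

/-! ### The adjoint of the preminimal operator -/

section Pairing

variable {F : ℝ → ℂ}

/-- The complex-valued analogue of `MemL2Loc`: the functions that pair with every compactly
supported element of `L²`. -/
def MemL2LocC (F : ℝ → ℂ) : Prop :=
  ∀ K : Set ℝ, IsCompact K → MemLp F 2 (volume.restrict K)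

theorem MemL2LocC.of_continuous (hF : Continuous F) : MemL2LocC F := fun K hK => by
  have : IsFiniteMeasure (volume.restrict K) := ⟨by simpa using hK.measure_lt_top⟩
  obtain ⟨C, hC⟩ := hK.exists_bound_of_continuousOn hF.continuousOn
  exact MemLp.of_bound hF.aestronglyMeasurable C
    ((ae_restrict_iff' hK.measurableSet).2 (Eventually.of_forall hC))

theorem MemL2LocC.sub {G : ℝ → ℂ} (hF : MemL2LocC F) (hG : MemL2LocC G) :
    MemL2LocC (fun x => F x - G x) :=
  fun K hK => (hF K hK).sub (hG K hK)

theorem MemL2LocC.locallyIntegrable (hF : MemL2LocC F) : LocallyIntegrable F volume :=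
  locallyIntegrable_iff.2 fun K hK => by
    have : IsFiniteMeasure (volume.restrict K) := ⟨by simpa using hK.measure_lt_top⟩
    exact (hF K hK).integrable (by norm_num)

theorem memL2LocC_L2 (f : L2) : MemL2LocC f := fun _ _ => (Lp.memLp f).restrict _

theorem toLp_mem_compactlySupported (hF : MemLp F 2 volume) (hsupp : HasCompactSupport F) :
    hF.toLp F ∈ compactlySupported :=
  ⟨F, hsupp, hF.coeFn_toLp⟩

theorem integrable_mul_conj (hF : MemL2LocC F) {h : L2} (hh : h ∈ compactlySupported) :
    Integrable (fun x => h x * conj (F x)) volume := by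
  obtain ⟨k, hk, hhk⟩ := hh
  refine IntegrableOn.integrable_of_ae_notMem_eq_zero (s := tsupport k)
    (((Lp.memLp h).restrict _).integrable_mul (hF _ hk).star) ?_
  filter_upwards [hhk] with x hx hxk
  rw [hx, image_eq_zero_of_notMem_tsupport hxk, zero_mul]

/-- The linear functional `h ↦ ∫ h F̄` on the compactly supported elements of `L²`. -/
def pairing (hF : MemL2LocC F) : compactlySupported →ₗ[ℂ] ℂ where
  toFun h := ∫ x, (h : L2) x * conj (F x)
  map_add' h k := by
    rw [← integral_add (integrable_mul_conj hF h.2) (integrable_mul_conj hF k.2)]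
    refine integral_congr_ae ?_
    filter_upwards [Lp.coeFn_add (h : L2) (k : L2)] with x hx
    rw [Submodule.coe_add, hx, Pi.add_apply, add_mul]
  map_smul' c h := by
    rw [RingHom.id_apply, smul_eq_mul, ← integral_const_mul]
    refine integral_congr_ae ?_
    filter_upwards [Lp.coeFn_smul c (h : L2)] with x hx
    rw [Submodule.coe_smul, hx, Pi.smul_apply, smul_eq_mul, mul_assoc]

theorem pairing_apply (hF : MemL2LocC F) (h : compactlySupported) :
    pairing hF h = ∫ x, (h : L2) x * conj (F x) := rfl

theorem ae_eq_zero_of_pairing_eq_zero (hF : MemL2LocC F) (h0 : pairing hF = 0) :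
    ∀ᵐ x : ℝ, F x = 0 := by
  have hconj : ∀ᵐ x : ℝ, conj (F x) = 0 := by
    refine ae_eq_zero_of_integral_contDiff_smul_eq_zero (locallyIntegrable_conj
      hF.locallyIntegrable) fun ψ hψ hψc => ?_
    have hψc' : HasCompactSupport fun x => (ψ x : ℂ) := hψc.comp_left Complex.ofReal_zero
    have hψ2 : MemLp (fun x => (ψ x : ℂ)) 2 volume :=
      (Complex.continuous_ofReal.comp hψ.continuous).memLp_of_hasCompactSupport hψc'
    have hpair := LinearMap.congr_fun h0 ⟨_, toLp_mem_compactlySupported hψ2 hψc'⟩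
    rw [pairing_apply, LinearMap.zero_apply] at hpair
    refine (integral_congr_ae ?_).trans hpair
    filter_upwards [hψ2.coeFn_toLp] with x hx
    rw [hx, Complex.real_smul]
  filter_upwards [hconj] with x hx
  exact (map_eq_zero _).1 hx

theorem exists_ae_eq_sum_of_pairing {ι : Type*} [Fintype ι] {y : ι → ℝ → ℂ}
    (hF : MemL2LocC F) (hy : ∀ i, MemL2LocC (y i))
    (hker : ∀ h, (∀ i, pairing (hy i) h = 0) → pairing hF h = 0) :
    ∃ c : ι → ℂ, ∀ᵐ x : ℝ, F x = ∑ i, c i * y i x := by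
  have hle : ⨅ i, LinearMap.ker (pairing (hy i)) ≤ LinearMap.ker (pairing hF) := fun h hh =>
    hker h fun i => Submodule.mem_iInf _ |>.1 hh i
  obtain ⟨c, hc⟩ := (Submodule.mem_span_range_iff_exists_fun ℂ).1
    (mem_span_of_iInf_ker_le_ker hle)
  have hsum : MemL2LocC fun x => ∑ i, conj (c i) * y i x := fun K hK =>
    memLp_finsetSum _ fun i _ => (hy i K hK).const_mul (conj (c i))
  have hzero : pairing (hF.sub hsum) = 0 := by
    ext h
    have hint (i : ι) := (integrable_mul_conj (hy i) h.2).const_mul (c i)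
    calc pairing (hF.sub hsum) h
        = ∫ x, ((h : L2) x * conj (F x) - ∑ i, c i * ((h : L2) x * conj (y i x))) := by
          refine integral_congr_ae (Eventually.of_forall fun x => ?_)
          simp only [map_sub, map_sum, map_mul, Complex.conj_conj, mul_sub, Finset.mul_sum,
            mul_left_comm]
      _ = pairing hF h - (∑ i, c i • pairing (hy i)) h := by
          rw [integral_sub (integrable_mul_conj hF h.2) (integrable_finsetSum _ fun i _ => hint i),
            integral_finsetSum _ fun i _ => hint i]
          simp only [integral_const_mul, LinearMap.sum_apply, LinearMap.smul_apply, smul_eq_mul,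
            pairing_apply]
      _ = 0 := by rw [hc, sub_self]
  refine ⟨fun i => conj (c i), ?_⟩
  filter_upwards [ae_eq_zero_of_pairing_eq_zero _ hzero] with x hx
  exact sub_eq_zero.1 hx

end Pairing

theorem L2_inner_eq (f g : L2) : ⟪f, g⟫_ℂ = ∫ x, g x * conj (f x) := by
  rw [L2.inner_def]
  rfl

theorem locallyIntegrable_L2 (f : L2) : LocallyIntegrable f volume :=
  (memL2LocC_L2 f).locallyIntegrable

theorem mem_maxGraph_compactlySupported_iff {w : L2 × L2} :
    w ∈ maxGraph p Q r s ∧ w.1 ∈ compactlySupported ↔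
      ∃ u v, w.1 =ᵐ[volume] u ∧ HasCompactSupport u ∧ IsQuasiSolution p Q r s u v w.2 := by
  constructor
  · rintro ⟨hw, k, hk, hwk⟩
    obtain ⟨u, v, hwu, hu⟩ := mem_maxGraph_iff.1 hw
    have hsub : tsupport u ⊆ tsupport k := by
      refine tsupport_subset_of_ae hu.ac.continuous (isClosed_tsupport k) ?_
      filter_upwards [hwu, hwk] with x hxu hxk hx
      rw [← hxu, hxk, image_eq_zero_of_notMem_tsupport hx]
    exact ⟨u, v, hwu, hk.isCompact.of_isClosed_subset (isClosed_tsupport u) hsub, hu⟩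
  · rintro ⟨u, v, hwu, hsupp, hu⟩
    exact ⟨mem_maxGraph_iff.2 ⟨u, v, hwu, hu⟩, u, hsupp, hwu⟩

theorem mem_graph_preminOp_iff {w : L2 × L2} :
    w ∈ (preminOp p Q r s).graph ↔ w ∈ maxGraph p Q r s ∧ w.1 ∈ compactlySupported := by
  rw [← graph_maxOp, LinearPMap.mem_graph_iff, LinearPMap.mem_graph_iff]
  constructor
  · rintro ⟨y, hy, hw⟩
    exact ⟨⟨⟨y, y.2.2⟩, hy, hw⟩, hy ▸ y.2.1⟩
  · rintro ⟨⟨y, hy, hw⟩, h⟩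
    exact ⟨⟨y, hy ▸ h, y.2⟩, hy, hw⟩

theorem Admissible.inner_symm (hc : Admissible p Q r s) {w f : L2 × L2}
    (hw : w ∈ (preminOp p Q r s).graph) (hf : f ∈ maxGraph p Q r s) :
    ⟪f.2, w.1⟫_ℂ = ⟪f.1, w.2⟫_ℂ := by
  obtain ⟨u, v, hwu, hsupp, hu⟩ :=
    mem_maxGraph_compactlySupported_iff.1 (mem_graph_preminOp_iff.1 hw)
  obtain ⟨y, z, hfy, hy⟩ := mem_maxGraph_iff.1 hf
  rw [L2_inner_eq, L2_inner_eq]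
  refine (integral_congr_ae ?_).trans ((hu.integral_mul_conj_eq hy hc.p_ne_zero
    (locallyIntegrable_L2 _) (locallyIntegrable_L2 _) hsupp).trans (integral_congr_ae ?_))
  · filter_upwards [hwu] with x hx
    rw [hx]
  · filter_upwards [hfy] with x hx
    rw [hx]

theorem Admissible.pairing_sub_eq_zero (hc : Admissible p Q r s) {f : L2 × L2}
    (hf : ∀ w ∈ (preminOp p Q r s).graph, ⟪f.2, w.1⟫_ℂ = ⟪f.1, w.2⟫_ℂ) {u₀ v₀ : ℝ → ℂ}
    (hu₀ : IsQuasiSolution p Q r s u₀ v₀ f.2) {h : compactlySupported} {w v : ℝ → ℂ}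
    (hw : IsQuasiSolution p Q r s w v (h : L2)) (hsupp : HasCompactSupport w) :
    pairing ((memL2LocC_L2 f.1).sub (.of_continuous hu₀.ac.continuous)) h = 0 := by
  have hw2 : MemLp w 2 volume := hw.ac.continuous.memLp_of_hasCompactSupport hsupp
  have hinner := hf (hw2.toLp w, h) (mem_graph_preminOp_iff.2
    (mem_maxGraph_compactlySupported_iff.2 ⟨w, v, hw2.coeFn_toLp, hsupp, hw⟩))
  rw [L2_inner_eq, L2_inner_eq] at hinner
  have hsolution : ∫ x, (hw2.toLp w) x * conj (f.2 x) = ∫ x, (h : L2) x * conj (u₀ x) := by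
    rw [← hw.integral_mul_conj_eq hu₀ hc.p_ne_zero (locallyIntegrable_L2 _)
      (locallyIntegrable_L2 _) hsupp]
    refine integral_congr_ae ?_
    filter_upwards [hw2.coeFn_toLp] with x hx
    rw [hx]
  simp only [pairing_apply, map_sub, mul_sub]
  rw [integral_sub (integrable_mul_conj (memL2LocC_L2 _) h.2)
    (integrable_mul_conj (.of_continuous hu₀.ac.continuous) h.2), ← hinner, hsolution, sub_self]

/-- With `l[u₀] = f.2`, the difference `f.1 - u₀` annihilates every compactly supported `h` that is
orthogonal to the solutions of `l[y] = 0`, because such an `h` equals `l[w]` for a compactly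
supported `w`. Hence `f.1 - u₀` is itself a solution of `l[y] = 0`. -/
theorem Admissible.mem_maxGraph_of_inner_symm (hc : Admissible p Q r s) {f : L2 × L2}
    (hf : ∀ w ∈ (preminOp p Q r s).graph, ⟪f.2, w.1⟫_ℂ = ⟪f.1, w.2⟫_ℂ) :
    f ∈ maxGraph p Q r s := by
  obtain ⟨u₀, v₀, hu₀, -, -⟩ := hc.exists_isQuasiSolution (locallyIntegrable_L2 f.2) 0 0 0
  obtain ⟨y, z, hy, hnondeg⟩ := hc.exists_fundamental
  obtain ⟨c, hcy⟩ := exists_ae_eq_sum_of_pairing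
    ((memL2LocC_L2 f.1).sub (.of_continuous hu₀.ac.continuous))
    (fun i => .of_continuous (hy i).ac.continuous) fun h horth => by
      obtain ⟨k, hk, hhk⟩ := h.2
      have hkint : LocallyIntegrable k volume := (locallyIntegrable_L2 h).congr hhk
      obtain ⟨w, v, hw, hsupp⟩ := hc.exists_isQuasiSolution_hasCompactSupport hy hnondeg hkint hk
        fun i => (integral_congr_ae (hhk.mono fun x hx => by rw [hx])).symm.trans (horth i)
      exact hc.pairing_sub_eq_zero hf hu₀ (hw.congr hhk) hsupp
  have hsol := (((hy 0).smul (c 0)).add ((hy 1).smul (c 1))).add hu₀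
  refine mem_maxGraph_iff.2 ⟨_, _, ?_, hsol.congr (by simp)⟩
  filter_upwards [hcy] with x hx
  rw [Fin.sum_univ_two] at hx
  exact sub_eq_iff_eq_add.1 hx

theorem Admissible.dense_domain_preminOp (hc : Admissible p Q r s) :
    Dense ((preminOp p Q r s).domain : Set L2) := by
  rw [Submodule.dense_iff_topologicalClosure_eq_top, Submodule.topologicalClosure_eq_top_iff,
    Submodule.eq_bot_iff]
  intro g hg
  refine maxGraph_functional p Q r s (0, g) (hc.mem_maxGraph_of_inner_symm fun w hw => ?_) rfl
  rw [inner_zero_left]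
  exact (Submodule.mem_orthogonal' _ _).1 hg _ (LinearPMap.mem_domain_of_mem_graph hw)

theorem Admissible.adjoint_preminOp (hc : Admissible p Q r s) :
    (preminOp p Q r s)† = maxOp p Q r s := by
  apply LinearPMap.eq_of_eq_graph
  rw [LinearPMap.adjoint_graph_eq_graph_adjoint hc.dense_domain_preminOp, graph_maxOp]
  ext f
  rw [Submodule.mem_adjoint_iff]
  constructor
  · intro h
    refine hc.mem_maxGraph_of_inner_symm fun w hw => ?_
    rw [← inner_conj_symm, ← sub_eq_zero.1 (h w.1 w.2 hw), inner_conj_symm]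
  · intro h a b hab
    rw [sub_eq_zero, ← inner_conj_symm, ← hc.inner_symm hab h, inner_conj_symm]

/-! ### Products of a `W¹₂` function with a cutoff -/

section Sobolev

theorem memLp_mul_of_continuous {𝕜 : Type*} [RCLike 𝕜] {f η : ℝ → 𝕜} {K : Set ℝ}
    (hf : MemLp f 2 (volume.restrict K)) (hK : IsCompact K) (hη : Continuous η)
    (h0 : ∀ x ∉ K, f x * η x = 0) : MemLp (fun x => f x * η x) 2 volume := by
  obtain ⟨C, hC⟩ := hK.exists_bound_of_continuousOn hη.continuousOn
  have hmul : MemLp (fun x => f x * η x) 2 (volume.restrict K) := by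
    refine hf.of_le_mul (c := C) (hf.aestronglyMeasurable.mul hη.aestronglyMeasurable)
      ((ae_restrict_iff' hK.measurableSet).2 (Eventually.of_forall fun x hx => ?_))
    rw [norm_mul, mul_comm]
    exact mul_le_mul_of_nonneg_right (hC x hx) (norm_nonneg _)
  rw [← memLp_indicator_iff_restrict hK.measurableSet] at hmul
  rwa [Set.indicator_eq_self.2 fun x hx => by_contra fun hxK => hx (h0 x hxK)] at hmul

theorem integrable_mul_of_continuous {f η : ℝ → ℝ} {K : Set ℝ}
    (hf : MemLp f 2 (volume.restrict K)) (hK : IsCompact K) (hη : Continuous η)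
    (h0 : ∀ x ∉ K, f x * η x = 0) : Integrable (fun x => f x * η x) volume := by
  have : IsFiniteMeasure (volume.restrict K) := ⟨by simpa using hK.measure_lt_top⟩
  exact IntegrableOn.integrable_of_ae_notMem_eq_zero
    (((memLp_mul_of_continuous hf hK hη h0).restrict K).integrable (by norm_num))
    (Eventually.of_forall h0)

theorem contDiff_integral {χ : ℝ → ℝ} (hχ : ContDiff ℝ ∞ χ) (c : ℝ) :
    ContDiff ℝ ∞ fun x => ∫ t in c..x, χ t := by
  have hd (x : ℝ) := intervalIntegral.integral_hasDerivAt_right (a := c) (b := x)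
    (hχ.continuous.intervalIntegrable _ _)
    hχ.continuous.stronglyMeasurable.stronglyMeasurableAtFilter hχ.continuous.continuousAt
  refine contDiff_infty_iff_deriv.2 ⟨fun x => (hd x).differentiableAt, ?_⟩
  rwa [funext fun x => (hd x).deriv]

theorem ae_eq_integral_of_weak_deriv {f G : ℝ → ℝ} {a b : ℝ} (hf : LocallyIntegrable f volume)
    (hG : LocallyIntegrable G volume) (hG0 : ∀ x ∉ Set.Icc a b, G x = 0)
    (hweak : ∀ Ψ : ℝ → ℝ, ContDiff ℝ ∞ Ψ → ∫ x, f x * deriv Ψ x = -∫ x, G x * Ψ x) :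
    ∀ᵐ x : ℝ, f x = ∫ t in a..x, G t := by
  set P : ℝ → ℝ := fun x => ∫ t in a..x, G t
  have hPac := absolutelyContinuousOnInterval_integral hG a
  have hPcont : Continuous P :=
    intervalIntegral.continuous_primitive (intervalIntegrable_of_locallyIntegrable hG) a
  have hG1 : ∫ x, G x = 0 := by simpa using hweak (fun _ => 1) contDiff_const
  have hPsupp : HasCompactSupport P := HasCompactSupport.intro isCompact_Icc fun x hx =>
    intervalIntegral_eq_zero_of_notMem hG0 hG1 hx
  have hzero : ∀ᵐ x : ℝ, f x - P x = 0 := by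
    refine ae_eq_zero_of_integral_contDiff_smul_eq_zero (hf.sub hPcont.locallyIntegrable)
      fun χ hχ hχc => ?_
    set Ψ : ℝ → ℝ := fun x => ∫ t in a..x, χ t
    have hΨ : ContDiff ℝ ∞ Ψ := contDiff_integral hχ a
    have hΨ' (x : ℝ) : HasDerivAt Ψ (χ x) x :=
      (hχ.continuous.integral_hasStrictDerivAt a x).hasDerivAt
    have hχP : Integrable (fun x => χ x * P x) volume :=
      (hχ.continuous.mul hPcont).integrable_of_hasCompactSupport hχc.mul_right
    have hχf : Integrable (fun x => χ x * f x) volume :=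
      hf.integrable_smul_left_of_hasCompactSupport hχ.continuous hχc
    have hΨG : Integrable (fun x => Ψ x * G x) volume :=
      IntegrableOn.integrable_of_ae_notMem_eq_zero ((LocallyIntegrable.continuous_mul
        hΨ.continuous hG).integrableOn_isCompact (isCompact_Icc (a := a) (b := b)))
        (Eventually.of_forall fun x hx => by rw [hG0 x hx, mul_zero])
    have hparts : ∫ x, (χ x * P x + Ψ x * G x) = 0 := by
      refine integral_eq_zero_of_hasCompactSupport (f := fun x => Ψ x * P x) (fun c d =>
        (hΨ.of_le (by simp)).contDiffOn.absolutelyContinuousOnInterval.fun_mul (hPac c d))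
        hPsupp.mul_left (hχP.add hΨG).locallyIntegrable ?_
      filter_upwards [ae_hasDerivAt_integral hG a] with x hx using (hΨ' x).mul hx
    have hweakΨ := hweak Ψ hΨ
    simp only [fun x => (hΨ' x).deriv, mul_comm _ (χ _), mul_comm (G _)] at hweakΨ
    simp only [smul_eq_mul, mul_sub]
    rw [integral_add hχP hΨG] at hparts
    rw [integral_sub hχf hχP]
    linarith
  filter_upwards [hzero] with x hx using sub_eq_zero.1 hx

/-- A weak derivative of `f θ` that is moreover tested against functions without compact support:
this is what makes its primitive vanish outside `[a, b]`. -/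
theorem MemW12.exists_weak_deriv_mul {f θ : ℝ → ℝ} {a b : ℝ} (hf : MemW12 f a b)
    (hθ : ContDiff ℝ ∞ θ) (hsupp : tsupport θ ⊆ Set.Ioo a b) :
    ∃ G : ℝ → ℝ, MemLp G 2 volume ∧ (∀ x ∉ Set.Icc a b, G x = 0) ∧
      ∀ Ψ : ℝ → ℝ, ContDiff ℝ ∞ Ψ → ∫ x, f x * θ x * deriv Ψ x = -∫ x, G x * Ψ x := by
  obtain ⟨hf2, g, hg2, hweak⟩ := hf
  have hθ' : ContDiff ℝ ∞ (deriv θ) := (contDiff_infty_iff_deriv.1 hθ).2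
  have hθ0 : ∀ x ∉ Set.Icc a b, θ x = 0 := fun x hx =>
    image_eq_zero_of_notMem_tsupport fun h => hx (Set.Ioo_subset_Icc_self (hsupp h))
  have hθ'0 : ∀ x ∉ Set.Icc a b, deriv θ x = 0 := fun x hx =>
    image_eq_zero_of_notMem_tsupport fun h =>
      hx (Set.Ioo_subset_Icc_self (hsupp (tsupport_deriv_subset h)))
  refine ⟨fun x => g x * θ x + f x * deriv θ x,
    (memLp_mul_of_continuous hg2 isCompact_Icc hθ.continuous
      fun x hx => by rw [hθ0 x hx, mul_zero]).add
    (memLp_mul_of_continuous hf2 isCompact_Icc hθ'.continuous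
      fun x hx => by rw [hθ'0 x hx, mul_zero]), fun x hx => by simp [hθ0 x hx, hθ'0 x hx],
    fun Ψ hΨ => ?_⟩
  have hΨ' : Continuous (deriv Ψ) := (contDiff_infty_iff_deriv.1 hΨ).2.continuous
  have htest := hweak (fun x => θ x * Ψ x) (hθ.mul hΨ)
    (HasCompactSupport.intro isCompact_Icc fun x hx => by rw [hθ0 x hx, zero_mul])
    ((tsupport_mul_subset_left (f := θ) (g := Ψ)).trans hsupp)
  have hd (x : ℝ) : deriv (fun x => θ x * Ψ x) x = deriv θ x * Ψ x + θ x * deriv Ψ x :=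
    deriv_fun_mul ((hθ.differentiable (by simp)) x) ((hΨ.differentiable (by simp)) x)
  have hfθ'Ψ := integrable_mul_of_continuous (η := fun x => deriv θ x * Ψ x) hf2 isCompact_Icc
    (hθ'.continuous.mul hΨ.continuous) fun x hx => by rw [hθ'0 x hx, zero_mul, mul_zero]
  have hfθΨ' := integrable_mul_of_continuous (η := fun x => θ x * deriv Ψ x) hf2 isCompact_Icc
    (hθ.continuous.mul hΨ') fun x hx => by rw [hθ0 x hx, zero_mul, mul_zero]
  have hgθΨ := integrable_mul_of_continuous (η := fun x => θ x * Ψ x) hg2 isCompact_Icc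
    (hθ.continuous.mul hΨ.continuous) fun x hx => by rw [hθ0 x hx, zero_mul, mul_zero]
  rw [setIntegral_eq_integral_of_forall_compl_eq_zero fun x hx => by
      rw [hd, hθ0 x hx, hθ'0 x hx, zero_mul, zero_mul, add_zero, mul_zero],
    setIntegral_eq_integral_of_forall_compl_eq_zero fun x hx => by
      rw [hθ0 x hx, zero_mul, mul_zero]] at htest
  simp only [hd, mul_add] at htest
  rw [integral_add hfθ'Ψ hfθΨ'] at htest
  simp only [add_mul, mul_assoc]
  rw [integral_add hgθΨ hfθ'Ψ]
  linarith

theorem MemW12.exists_ae_eq_mul {f θ : ℝ → ℝ} {a b : ℝ} (hf : MemW12 f a b)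
    (hθ : ContDiff ℝ ∞ θ) (hsupp : tsupport θ ⊆ Set.Ioo a b) :
    ∃ P : ℝ → ℝ, (∀ c d, AbsolutelyContinuousOnInterval P c d) ∧
      (∀ᵐ x : ℝ, P x = f x * θ x) ∧ MemLp (deriv P) 2 volume := by
  obtain ⟨G, hG2, hG0, hweak⟩ := hf.exists_weak_deriv_mul hθ hsupp
  have hG : LocallyIntegrable G volume := hG2.locallyIntegrable (by norm_num)
  have hfθ : MemLp (fun x => f x * θ x) 2 volume :=
    memLp_mul_of_continuous hf.1 isCompact_Icc hθ.continuous fun x hx => by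
      rw [image_eq_zero_of_notMem_tsupport fun h => hx (Set.Ioo_subset_Icc_self (hsupp h)),
        mul_zero]
  refine ⟨fun x => ∫ t in a..x, G t, absolutelyContinuousOnInterval_integral hG a,
    (ae_eq_integral_of_weak_deriv (hfθ.locallyIntegrable (by norm_num)) hG hG0 hweak).mono
      fun x hx => hx.symm, hG2.ae_eq ?_⟩
  filter_upwards [ae_hasDerivAt_integral hG a] with x hx using hx.deriv.symm

end Sobolev

/-! ### The energy estimate -/

section Cutoff

variable {φ ψ P R : ℝ → ℝ}

theorem ACLoc.ofReal {f : ℝ → ℝ} (hf : ∀ a b, AbsolutelyContinuousOnInterval f a b) :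
    ACLoc fun x => (f x : ℂ) := fun a b =>
  absolutelyContinuousOnInterval_contDiff_comp Complex.ofRealCLM.contDiff (hf a b)

theorem re_inner_toLp {f h : ℝ → ℂ} (hf : MemLp f 2 volume) (hh : MemLp h 2 volume) :
    (⟪hf.toLp, hh.toLp⟫_ℂ).re = ∫ x, (h x * conj (f x)).re := by
  have hint : Integrable (fun x => h x * conj (f x)) volume := hh.integrable_mul hf.star
  refine Eq.trans ?_ (integral_re hint).symm
  rw [L2_inner_eq, RCLike.re_eq_complex_re]
  refine congrArg Complex.re (integral_congr_ae ?_)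
  filter_upwards [hf.coeFn_toLp, hh.coeFn_toLp] with x hx hx'
  rw [hx, hx']

theorem norm_sq_toLp {f : ℝ → ℂ} (hf : MemLp f 2 volume) :
    ‖hf.toLp‖ ^ 2 = ∫ x, ‖f x‖ ^ 2 := by
  rw [← inner_self_eq_norm_sq (𝕜 := ℂ), RCLike.re_eq_complex_re, re_inner_toLp]
  simp only [Complex.mul_conj, Complex.normSq_eq_norm_sq, Complex.ofReal_re]

/-- A cutoff function `φ` that maps solutions to functions in the domain of `L`, up to compact
support. Since `p` need not be continuous, the product `p φ'` is represented by a locally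
absolutely continuous version `P`. -/
structure IsCutoff (p Q φ P : ℝ → ℝ) : Prop where
  contDiff : ContDiff ℝ 1 φ
  ac : ∀ a b, AbsolutelyContinuousOnInterval P a b
  ae_eq : ∀ᵐ x : ℝ, P x = p x * deriv φ x
  memLp_deriv : MemLp (deriv P) 2 volume
  memLp_mul : MemLp (fun x => Q x * deriv φ x) 2 volume

/-- The value `l[φ u]` of the quasi-differential expression, where `v = u^[1]` and `g = l[u]`. -/
def cutoffSource (Q φ P : ℝ → ℝ) (u v g : ℝ → ℂ) (x : ℝ) : ℂ :=
  φ x * g x - 2 * deriv φ x * (v x + Q x * u x) - deriv P x * u x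

namespace IsCutoff

theorem hasDerivAt (hφ : IsCutoff p Q φ P) (x : ℝ) : HasDerivAt φ (deriv φ x) x :=
  (hφ.contDiff.differentiable one_ne_zero x).hasDerivAt

theorem continuous_deriv (hφ : IsCutoff p Q φ P) : Continuous (deriv φ) :=
  hφ.contDiff.continuous_deriv_one

theorem continuous_primitive (hφ : IsCutoff p Q φ P) : Continuous P :=
  Complex.continuous_re.comp (ACLoc.ofReal hφ.ac).continuous

theorem ae_hasDerivAt_primitive (hφ : IsCutoff p Q φ P) :
    ∀ᵐ x : ℝ, HasDerivAt P (deriv P x) x := by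
  filter_upwards [(ACLoc.ofReal hφ.ac).ae_differentiableAt] with x hx
  exact (Complex.reCLM.differentiableAt.comp x hx).hasDerivAt

theorem sub (hφ : IsCutoff p Q φ P) (hψ : IsCutoff p Q ψ R) :
    IsCutoff p Q (fun x => φ x - ψ x) fun x => P x - R x := by
  have hderiv (x : ℝ) : deriv (fun x => φ x - ψ x) x = deriv φ x - deriv ψ x :=
    ((hφ.hasDerivAt x).sub (hψ.hasDerivAt x)).deriv
  refine ⟨hφ.contDiff.sub hψ.contDiff, fun a b => (hφ.ac a b).fun_sub (hψ.ac a b), ?_,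
    (hφ.memLp_deriv.sub hψ.memLp_deriv).ae_eq ?_, ?_⟩
  · filter_upwards [hφ.ae_eq, hψ.ae_eq] with x h h'
    rw [hderiv, h, h', mul_sub]
  · filter_upwards [hφ.ae_hasDerivAt_primitive, hψ.ae_hasDerivAt_primitive] with x h h'
    exact (h.sub h').deriv.symm
  · simp only [hderiv, mul_sub]
    exact hφ.memLp_mul.sub hψ.memLp_mul

theorem tsupport_deriv_primitive_subset (hφ : IsCutoff p Q φ P) :
    tsupport (deriv P) ⊆ tsupport (deriv φ) :=
  tsupport_deriv_subset.trans (tsupport_subset_of_ae hφ.continuous_primitive (isClosed_tsupport _)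
    (hφ.ae_eq.mono fun x hx h => by rw [hx, image_eq_zero_of_notMem_tsupport h, mul_zero]))

theorem isQuasiSolution (hφ : IsCutoff p Q φ P) (hu : IsQuasiSolution p Q r s u v g)
    (hp : ∀ᵐ x : ℝ, p x ≠ 0) :
    IsQuasiSolution p Q r s (fun x => φ x * u x) (fun x => φ x * v x + P x * u x)
      (cutoffSource Q φ P u v g) := by
  have hφac : ACLoc fun x => (φ x : ℂ) := .of_contDiff (Complex.ofRealCLM.contDiff.comp hφ.contDiff)
  have hφ' (x : ℝ) := (hφ.hasDerivAt x).ofReal_comp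
  refine ⟨hφac.mul hu.ac, (hφac.mul hu.ac_quasiDeriv).add ((ACLoc.ofReal hφ.ac).mul hu.ac), ?_, ?_⟩
  · filter_upwards [hu.ae_hasDerivAt hp, hφ.ae_eq, hp] with x hu' hP hpx
    have hpx' : (p x : ℂ) ≠ 0 := by exact_mod_cast hpx
    rw [quasiDeriv₁, ((hφ' x).fun_mul hu').deriv, hP]
    push_cast
    field_simp
    ring
  · filter_upwards [hu.ae_hasDerivAt hp, hu.ae_hasDerivAt_quasiDeriv, hφ.ae_eq,
      hφ.ae_hasDerivAt_primitive, hp] with x hu' hv' hP hP' hpx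
    have hpx' : (p x : ℂ) ≠ 0 := by exact_mod_cast hpx
    rw [quasiDeriv₂, (((hφ' x).fun_mul hv').fun_add (hP'.ofReal_comp.fun_mul hu')).deriv,
      cutoffSource, hP]
    push_cast
    field_simp
    ring

theorem ae_hasDerivAt_energy (hφ : IsCutoff p Q φ P) (hu : IsQuasiSolution p Q r s u v g)
    (hp : ∀ᵐ x : ℝ, p x ≠ 0) :
    ∀ᵐ x : ℝ, HasDerivAt (fun x => φ x * P x * ‖u x‖ ^ 2)
      (φ x ^ 2 * (g x * conj (u x)).re + deriv φ x * P x * ‖u x‖ ^ 2 -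
        (cutoffSource Q φ P u v g x * conj (φ x * u x)).re) x := by
  filter_upwards [hu.ae_hasDerivAt hp, hφ.ae_eq, hφ.ae_hasDerivAt_primitive, hp]
    with x hu' hP hP' hpx
  refine (((hφ.hasDerivAt x).fun_mul hP').fun_mul hu'.norm_sq).congr_deriv ?_
  set D := (v x + (Q x + Complex.I * r x) * u x) / p x
  have hPD : (P x : ℂ) * D = deriv φ x * (v x + (Q x + Complex.I * r x) * u x) := by
    have hpx' : (p x : ℂ) ≠ 0 := by exact_mod_cast hpx
    rw [hP, Complex.ofReal_mul]
    simp only [D]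
    field_simp
  have hre := congrArg Complex.re hPD
  have him := congrArg Complex.im hPD
  simp only [cutoffSource, Complex.inner, ← Complex.normSq_eq_norm_sq, Complex.normSq_apply,
    Complex.mul_re, Complex.mul_im, Complex.add_re, Complex.add_im, Complex.sub_re,
    Complex.sub_im, Complex.conj_re, Complex.conj_im, Complex.ofReal_re, Complex.ofReal_im,
    Complex.I_re, Complex.I_im, Complex.re_ofNat, Complex.im_ofNat, map_mul,
    Complex.conj_ofReal] at hre him ⊢
  linear_combination 2 * φ x * (u x).re * hre + 2 * φ x * (u x).im * him

theorem memLp_cutoffSource (hφ : IsCutoff p Q φ P) (hsupp : HasCompactSupport φ)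
    (hu : Continuous u) (hv : Continuous v) (hg : Continuous g) :
    MemLp (cutoffSource Q φ P u v g) 2 volume := by
  have hmul {f : ℝ → ℝ} {w : ℝ → ℂ} (hf : MemLp f 2 volume)
      (hsub : tsupport f ⊆ tsupport φ) (hw : Continuous w) :
      MemLp (fun x => (f x : ℂ) * w x) 2 volume :=
    memLp_mul_of_continuous (hf.ofReal.restrict _) hsupp hw fun x hx => by
      rw [image_eq_zero_of_notMem_tsupport fun h => hx (hsub h), Complex.ofReal_zero, zero_mul]
  have hφ'sub : tsupport (deriv φ) ⊆ tsupport φ := tsupport_deriv_subset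
  have hφg := hmul (hφ.contDiff.continuous.memLp_of_hasCompactSupport hsupp) subset_rfl hg
  have hφ'v := hmul (hφ.continuous_deriv.memLp_of_hasCompactSupport hsupp.deriv) hφ'sub hv
  have hQφ'u := hmul hφ.memLp_mul ((tsupport_mul_subset_right).trans hφ'sub) hu
  have hP'u := hmul hφ.memLp_deriv (hφ.tsupport_deriv_primitive_subset.trans hφ'sub) hu
  refine ((hφg.sub ((hφ'v.add hQφ'u).const_mul 2)).sub hP'u).ae_eq
    (Eventually.of_forall fun x => ?_)
  simp only [cutoffSource, Pi.sub_apply, Pi.add_apply]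
  push_cast
  ring

theorem integral_re_mul_conj (hφ : IsCutoff p Q φ P) (hu : IsQuasiSolution p Q r s u v g)
    (hp : ∀ᵐ x : ℝ, p x ≠ 0) (hsupp : HasCompactSupport φ) (hg : Continuous g) :
    ∫ x, (cutoffSource Q φ P u v g x * conj (φ x * u x)).re =
      (∫ x, φ x ^ 2 * (g x * conj (u x)).re) + ∫ x, deriv φ x * P x * ‖u x‖ ^ 2 := by
  have huc := hu.ac.continuous
  have hφc := hφ.contDiff.continuous
  have hφu : MemLp (fun x => φ x * u x) 2 volume := by
    refine ((Complex.continuous_ofReal.comp hφc).mul huc).memLp_of_hasCompactSupport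
      (HasCompactSupport.intro hsupp fun x hx => ?_)
    simp [image_eq_zero_of_notMem_tsupport hx]
  have hsource : Integrable
      (fun x => (cutoffSource Q φ P u v g x * conj (φ x * u x)).re) volume :=
    ((hφ.memLp_cutoffSource hsupp huc hu.ac_quasiDeriv.continuous hg).integrable_mul
      hφu.star).re
  have hgu : Integrable (fun x => φ x ^ 2 * (g x * conj (u x)).re) volume :=
    ((hφc.pow 2).mul (Complex.continuous_re.comp
      (hg.mul (Complex.continuous_conj.comp huc)))).integrable_of_hasCompactSupport
      (HasCompactSupport.intro hsupp fun x hx => by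
        simp [image_eq_zero_of_notMem_tsupport hx])
  have hPu : Integrable (fun x => deriv φ x * P x * ‖u x‖ ^ 2) volume :=
    ((hφ.continuous_deriv.mul hφ.continuous_primitive).mul
      (huc.norm.pow 2)).integrable_of_hasCompactSupport hsupp.deriv.mul_right.mul_right
  have hzero := integral_eq_zero_of_hasCompactSupport
    (fun a b => (hφ.contDiff.contDiffOn.absolutelyContinuousOnInterval.fun_mul
      (hφ.ac a b)).fun_mul (absolutelyContinuousOnInterval_contDiff_comp (contDiff_norm_sq ℝ)
        (hu.ac a b)))
    hsupp.mul_right.mul_right ((hgu.add hPu).sub hsource).locallyIntegrable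
    (hφ.ae_hasDerivAt_energy hu hp)
  rw [integral_sub' (hgu.add hPu) hsource, integral_add' hgu hPu] at hzero
  linarith

theorem integral_le (hφ : IsCutoff p Q φ P) {c l : ℝ} (hp : ∀ᵐ x : ℝ, p x ≠ 0)
    (hbelow : ∀ w ∈ (preminOp p Q r s).graph, c * ‖w.1‖ ^ 2 ≤ (⟪w.1, w.2⟫_ℂ).re)
    (hu : IsQuasiSolution p Q r s u v fun x => l * u x) (hsupp : HasCompactSupport φ) :
    (c - l) * ∫ x, φ x ^ 2 * ‖u x‖ ^ 2 ≤ ∫ x, deriv φ x * P x * ‖u x‖ ^ 2 := by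
  have huc := hu.ac.continuous
  have hg : Continuous fun x => (l : ℂ) * u x := continuous_const.mul huc
  have hφu := hφ.isQuasiSolution hu hp
  have hφusupp : HasCompactSupport fun x => (φ x : ℂ) * u x :=
    HasCompactSupport.intro hsupp fun x hx => by simp [image_eq_zero_of_notMem_tsupport hx]
  have hw := hφu.ac.continuous.memLp_of_hasCompactSupport (p := 2) (μ := volume) hφusupp
  have hh := hφ.memLp_cutoffSource hsupp huc hu.ac_quasiDeriv.continuous hg
  have hmem : (hw.toLp, hh.toLp) ∈ (preminOp p Q r s).graph :=
    mem_graph_preminOp_iff.2 (mem_maxGraph_compactlySupported_iff.2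
      ⟨_, _, hw.coeFn_toLp, hφusupp, hφu.congr hh.coeFn_toLp⟩)
  have hle := hbelow _ hmem
  rw [norm_sq_toLp, re_inner_toLp, hφ.integral_re_mul_conj hu hp hsupp hg] at hle
  simp only [norm_mul, Complex.norm_real, mul_pow, Real.norm_eq_abs, sq_abs, mul_assoc,
    Complex.mul_conj, Complex.normSq_eq_norm_sq, ← Complex.ofReal_mul, Complex.ofReal_re,
    mul_left_comm _ l, integral_const_mul] at hle ⊢
  linarith

end IsCutoff

end Cutoff

/-! ### Transition functions -/

section Transition

variable {a b M C K : ℝ} {σ P : ℝ → ℝ}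

theorem deriv_eq_zero_of_step (h0 : ∀ x ≤ a, σ x = 0) (h1 : ∀ x, b ≤ x → σ x = 1) {x : ℝ}
    (hx : x ∉ Set.Icc a b) : deriv σ x = 0 := by
  rcases not_and_or.1 hx with h | h
  · have hconst : σ =ᶠ[𝓝 x] fun _ => 0 := by
      filter_upwards [Iio_mem_nhds (not_le.1 h)] with y hy using h0 y hy.le
    rw [hconst.deriv_eq, deriv_const]
  · have hconst : σ =ᶠ[𝓝 x] fun _ => 1 := by
      filter_upwards [Ioi_mem_nhds (not_le.1 h)] with y hy using h1 y hy.le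
    rw [hconst.deriv_eq, deriv_const]

/-- A smooth step rising from `0` to `1` in the middle third of `[a, b]`, so that the support of
its derivative is a compact subset of the open interval. -/
def smoothStep (a b x : ℝ) : ℝ :=
  Real.smoothTransition (3 * (x - a) / (b - a) - 1)

theorem contDiff_smoothStep : ContDiff ℝ ∞ (smoothStep a b) :=
  Real.smoothTransition.contDiff.comp (by fun_prop)

theorem smoothStep_eq_zero (hab : a < b) {x : ℝ} (hx : x ≤ a + (b - a) / 3) :
    smoothStep a b x = 0 := by
  refine Real.smoothTransition.zero_of_nonpos ?_
  rw [sub_nonpos, div_le_one (sub_pos.2 hab)]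
  linarith

theorem smoothStep_eq_one (hab : a < b) {x : ℝ} (hx : b - (b - a) / 3 ≤ x) :
    smoothStep a b x = 1 := by
  refine Real.smoothTransition.one_of_one_le ?_
  rw [le_sub_iff_add_le, le_div_iff₀ (sub_pos.2 hab)]
  linarith

theorem tsupport_deriv_smoothStep_subset (hab : a < b) :
    tsupport (deriv (smoothStep a b)) ⊆ Set.Ioo a b := by
  have hsub : tsupport (deriv (smoothStep a b)) ⊆
      Set.Icc (a + (b - a) / 3) (b - (b - a) / 3) :=
    closure_minimal (fun x hx => by_contra fun h => hx (deriv_eq_zero_of_step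
      (fun y hy => smoothStep_eq_zero hab hy) (fun y hy => smoothStep_eq_one hab hy) h))
      isClosed_Icc
  exact hsub.trans (Set.Icc_subset_Ioo (by linarith) (by linarith))

theorem exists_abs_deriv_smoothStep_le :
    ∃ K : ℝ, ∀ a b, a < b → ∀ x, |deriv (smoothStep a b) x| ≤ K / (b - a) := by
  have hτ : ContDiff ℝ 1 Real.smoothTransition := Real.smoothTransition.contDiff
  obtain ⟨C, hC⟩ := (HasCompactSupport.intro isCompact_Icc fun x hx =>
    deriv_eq_zero_of_step (fun y hy => Real.smoothTransition.zero_of_nonpos hy)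
      (fun y hy => Real.smoothTransition.one_of_one_le hy) hx).exists_bound_of_continuous
    hτ.continuous_deriv_one
  refine ⟨C * 3, fun a b hab x => ?_⟩
  have haffine : HasDerivAt (fun x => 3 * (x - a) / (b - a) - 1) (3 / (b - a)) x := by
    simpa using ((((hasDerivAt_id x).sub_const a).const_mul 3).div_const (b - a)).sub_const 1
  have hderiv : deriv (smoothStep a b) x = _ :=
    ((hτ.differentiable one_ne_zero _).hasDerivAt.comp x haffine).deriv
  have hpos : 0 ≤ 3 / (b - a) := div_nonneg (by norm_num) (sub_pos.2 hab).le
  rw [hderiv, abs_mul, abs_of_nonneg hpos, mul_div_assoc C]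
  exact mul_le_mul_of_nonneg_right (hC _) hpos

/-- A cutoff function rising from `0` to `1` on `[a, b]` whose energy density `p σ'²` is at most
`M` there. -/
structure IsTransition (p Q : ℝ → ℝ) (a b M : ℝ) (σ P : ℝ → ℝ) : Prop
    extends IsCutoff p Q σ P where
  eq_zero : ∀ x ≤ a, σ x = 0
  eq_one : ∀ x, b ≤ x → σ x = 1
  deriv_mul_le : ∀ᵐ x : ℝ, x ∈ Set.Icc a b → deriv σ x * P x ≤ M

theorem Admissible.memLp_Q (hc : Admissible p Q r s) {E : Set ℝ} (hE : IsCompact E)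
    (hbound : ∀ᵐ x : ℝ, x ∈ E → |p x| ≤ M) : MemLp Q 2 (volume.restrict E) := by
  refine (hc.Q_div_sqrt E hE).of_le_mul (c := √M)
    (hc.aestronglyMeasurable_of_div_sqrt hc.Q_div_sqrt).restrict ?_
  rw [ae_restrict_iff' hE.measurableSet]
  filter_upwards [hbound, hc.p_ne_zero] with x hx hpx hxE
  have hsqrt : 0 < √|p x| := Real.sqrt_pos.2 (abs_pos.2 hpx)
  calc ‖Q x‖ = √|p x| * ‖Q x / √|p x|‖ := by
        rw [norm_div, Real.norm_of_nonneg hsqrt.le, mul_div_cancel₀ _ hsqrt.ne']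
    _ ≤ √M * ‖Q x / √|p x|‖ :=
        mul_le_mul_of_nonneg_right (Real.sqrt_le_sqrt (hx hxE)) (norm_nonneg _)

theorem Admissible.exists_isTransition (hc : Admissible p Q r s) (hab : a < b)
    (hp : MemW12 p a b) (hbound : ∀ᵐ x : ℝ, x ∈ Set.Icc a b → |p x| ≤ C * (b - a) ^ 2)
    (hK : ∀ x, |deriv (smoothStep a b) x| ≤ K / (b - a)) :
    ∃ P, IsTransition p Q a b (C * K ^ 2) (smoothStep a b) P := by
  have hσ : ContDiff ℝ ∞ (smoothStep a b) := contDiff_smoothStep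
  have hσ' : ContDiff ℝ ∞ (deriv (smoothStep a b)) := (contDiff_infty_iff_deriv.1 hσ).2
  have hsupp := tsupport_deriv_smoothStep_subset hab
  obtain ⟨P, hPac, hP, hP2⟩ := hp.exists_ae_eq_mul hσ' hsupp
  refine ⟨P, ⟨hσ.of_le (by simp), hPac, hP, hP2, ?_⟩, fun x hx => ?_, fun x hx => ?_, ?_⟩
  · exact memLp_mul_of_continuous (hc.memLp_Q isCompact_Icc hbound) isCompact_Icc hσ'.continuous
      fun x hx => by rw [image_eq_zero_of_notMem_tsupport fun h =>
        hx (Set.Ioo_subset_Icc_self (hsupp h)), mul_zero]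
  · exact smoothStep_eq_zero hab (by linarith)
  · exact smoothStep_eq_one hab (by linarith)
  · filter_upwards [hP, hbound] with x hPx hpx hx
    have hba : b - a ≠ 0 := (sub_pos.2 hab).ne'
    calc deriv (smoothStep a b) x * P x = p x * |deriv (smoothStep a b) x| ^ 2 := by
          rw [hPx, sq_abs]
          ring
      _ ≤ C * (b - a) ^ 2 * (K / (b - a)) ^ 2 := by
          have hC := (abs_nonneg _).trans (hpx hx)
          gcongr
          · exact (le_abs_self _).trans (hpx hx)
          · exact hK x
      _ = C * K ^ 2 := by field_simp

end Transition

section Eigenfunction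

variable {a b a' b' M C c l : ℝ} {σ τ P R : ℝ → ℝ}

namespace IsTransition

theorem lt (hσ : IsTransition p Q a b M σ P) : a < b := by
  refine lt_of_not_ge fun h => zero_ne_one (α := ℝ) ?_
  rw [← hσ.eq_zero a le_rfl, hσ.eq_one a h]

theorem deriv_eq_zero (hσ : IsTransition p Q a b M σ P) {x : ℝ} (hx : x ∉ Set.Icc a b) :
    deriv σ x = 0 :=
  deriv_eq_zero_of_step hσ.eq_zero hσ.eq_one hx

theorem integrable_energy (hσ : IsTransition p Q a b M σ P) (hu : Continuous u) :
    Integrable (fun x => deriv σ x * P x * ‖u x‖ ^ 2) volume :=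
  ((hσ.continuous_deriv.mul hσ.continuous_primitive).mul
    (hu.norm.pow 2)).integrable_of_hasCompactSupport
    (HasCompactSupport.intro (K := Set.Icc a b) isCompact_Icc fun x hx => by
      simp [hσ.deriv_eq_zero hx])

theorem integral_energy_le (hσ : IsTransition p Q a b M σ P) (hu : Continuous u) :
    ∫ x, deriv σ x * P x * ‖u x‖ ^ 2 ≤ M * ∫ x in a..b, ‖u x‖ ^ 2 := by
  rw [← setIntegral_eq_integral_of_forall_compl_eq_zero (s := Set.Icc a b) fun x hx => by
      rw [hσ.deriv_eq_zero hx, zero_mul, zero_mul],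
    intervalIntegral.integral_of_le hσ.lt.le, ← integral_Icc_eq_integral_Ioc,
    ← integral_const_mul]
  refine setIntegral_mono_on_ae (hσ.integrable_energy hu).integrableOn
    (continuous_const.mul (hu.norm.pow 2)).continuousOn.integrableOn_Icc measurableSet_Icc ?_
  filter_upwards [hσ.deriv_mul_le] with x hx hxI
  exact mul_le_mul_of_nonneg_right (hx hxI) (sq_nonneg _)

theorem hasCompactSupport_sub (hσ : IsTransition p Q a b M σ P)
    (hτ : IsTransition p Q a' b' M τ R) (hle : b ≤ a') :
    HasCompactSupport fun x => σ x - τ x := by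
  refine HasCompactSupport.intro (K := Set.Icc a b') isCompact_Icc fun x hx => ?_
  have hab := hσ.lt
  have hab' := hτ.lt
  rcases not_and_or.1 hx with h | h
  · rw [hσ.eq_zero x (by linarith), hτ.eq_zero x (by linarith), sub_zero]
  · rw [hσ.eq_one x (by linarith), hτ.eq_one x (by linarith), sub_self]

theorem intervalIntegral_le_integral_sq_mul (hσ : IsTransition p Q a b M σ P)
    (hτ : IsTransition p Q a' b' M τ R) (hle : b ≤ a') (hu : Continuous u) :
    ∫ x in b..a', ‖u x‖ ^ 2 ≤ ∫ x, (σ x - τ x) ^ 2 * ‖u x‖ ^ 2 := by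
  have hint : Integrable (fun x => (σ x - τ x) ^ 2 * ‖u x‖ ^ 2) volume :=
    (((hσ.contDiff.continuous.sub hτ.contDiff.continuous).pow 2).mul
      (hu.norm.pow 2)).integrable_of_hasCompactSupport
      (HasCompactSupport.intro (hσ.hasCompactSupport_sub hτ hle) fun x hx => by
        have hx' : σ x - τ x = 0 := image_eq_zero_of_notMem_tsupport (f := fun x => σ x - τ x) hx
        simp [hx'])
  rw [intervalIntegral.integral_of_le hle]
  calc ∫ x in Set.Ioc b a', ‖u x‖ ^ 2 = ∫ x in Set.Ioc b a', (σ x - τ x) ^ 2 * ‖u x‖ ^ 2 :=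
        setIntegral_congr_fun measurableSet_Ioc fun x hx => by
          simp only [hσ.eq_one x hx.1.le, hτ.eq_zero x hx.2, sub_zero, one_pow, one_mul]
    _ ≤ ∫ x, (σ x - τ x) ^ 2 * ‖u x‖ ^ 2 :=
        setIntegral_le_integral hint (Eventually.of_forall fun x => by positivity)

theorem integral_energy_sub (hσ : IsTransition p Q a b M σ P)
    (hτ : IsTransition p Q a' b' M τ R) (hlt : b < a') (hu : Continuous u) :
    ∫ x, deriv (fun x => σ x - τ x) x * (P x - R x) * ‖u x‖ ^ 2 =
      (∫ x, deriv σ x * P x * ‖u x‖ ^ 2) + ∫ x, deriv τ x * R x * ‖u x‖ ^ 2 := by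
  rw [← integral_add (hσ.integrable_energy hu) (hτ.integrable_energy hu)]
  refine integral_congr_ae ?_
  filter_upwards [hσ.ae_eq, hτ.ae_eq] with x hP hR
  have hdisjoint : deriv σ x * deriv τ x = 0 := by
    by_cases hx : x ∈ Set.Icc a b
    · rw [hτ.deriv_eq_zero fun h => absurd h.1 (by linarith [hx.2]), mul_zero]
    · rw [hσ.deriv_eq_zero hx, zero_mul]
  rw [((hσ.hasDerivAt x).fun_sub (hτ.hasDerivAt x)).deriv, hP, hR]
  linear_combination -2 * p x * ‖u x‖ ^ 2 * hdisjoint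

theorem mul_intervalIntegral_le (hσ : IsTransition p Q a b M σ P)
    (hτ : IsTransition p Q a' b' M τ R) (hlt : b < a') (hp : ∀ᵐ x : ℝ, p x ≠ 0)
    (hbelow : ∀ w ∈ (preminOp p Q r s).graph, c * ‖w.1‖ ^ 2 ≤ (⟪w.1, w.2⟫_ℂ).re) (hl : l ≤ c)
    (hu : IsQuasiSolution p Q r s u v fun x => l * u x) :
    (c - l) * ∫ x in b..a', ‖u x‖ ^ 2 ≤
      M * (∫ x in a..b, ‖u x‖ ^ 2) + M * ∫ x in a'..b', ‖u x‖ ^ 2 := by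
  have huc := hu.ac.continuous
  calc (c - l) * ∫ x in b..a', ‖u x‖ ^ 2
      ≤ (c - l) * ∫ x, (σ x - τ x) ^ 2 * ‖u x‖ ^ 2 :=
        mul_le_mul_of_nonneg_left (hσ.intervalIntegral_le_integral_sq_mul hτ hlt.le huc)
          (sub_nonneg.2 hl)
    _ ≤ ∫ x, deriv (fun x => σ x - τ x) x * (P x - R x) * ‖u x‖ ^ 2 :=
        (hσ.toIsCutoff.sub hτ.toIsCutoff).integral_le hp hbelow hu
          (hσ.hasCompactSupport_sub hτ hlt.le)
    _ = _ := hσ.integral_energy_sub hτ hlt huc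
    _ ≤ _ := add_le_add (hσ.integral_energy_le huc) (hτ.integral_energy_le huc)

end IsTransition

theorem tendsto_intervalIntegral_zero {ι : Type*} {k : Filter ι} {k' : Filter ℝ} {f : ℝ → ℝ}
    {y : ℝ} {α β : ι → ℝ} (hf : LocallyIntegrable f volume)
    (hlim : Tendsto (fun x => ∫ t in (0 : ℝ)..x, f t) k' (𝓝 y)) (hα : Tendsto α k k')
    (hβ : Tendsto β k k') : Tendsto (fun i => ∫ t in α i..β i, f t) k (𝓝 0) := by
  have hint := intervalIntegrable_of_locallyIntegrable hf
  have hsub := (hlim.comp hβ).sub (hlim.comp hα)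
  rw [sub_self] at hsub
  exact hsub.congr fun i =>
    intervalIntegral.integral_interval_sub_left (hint 0 (β i)) (hint 0 (α i))

theorem exists_isQuasiSolution_of_mem_maxGraph {f : L2} (hf : (f, (l : ℂ) • f) ∈ maxGraph p Q r s) :
    ∃ u v, f =ᵐ[volume] u ∧ IsQuasiSolution p Q r s u v fun x => l * u x := by
  obtain ⟨u, v, hfu, hu⟩ := mem_maxGraph_iff.1 hf
  refine ⟨u, v, hfu, hu.congr ?_⟩
  filter_upwards [Lp.coeFn_smul (l : ℂ) f, hfu] with x hx hfx
  rw [hx, Pi.smul_apply, hfx, smul_eq_mul]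

theorem Admissible.ae_eq_zero_of_eigenfunction (hc : Admissible p Q r s)
    (hbelow : ∀ w ∈ (preminOp p Q r s).graph, c * ‖w.1‖ ^ 2 ≤ (⟪w.1, w.2⟫_ℂ).re)
    {a b : ℤ → ℝ} (hab : ∀ n, a n < b n) (hb : Tendsto b atBot atBot) (ha : Tendsto a atTop atTop)
    (hp : ∀ n, MemW12 p (a n) (b n))
    (hbound : ∀ n, ∀ᵐ x : ℝ, x ∈ Set.Icc (a n) (b n) → |p x| ≤ C * (b n - a n) ^ 2)
    (hl : l < c) (hu : IsQuasiSolution p Q r s u v fun x => l * u x) (hu2 : MemLp u 2 volume) :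
    u =ᵐ[volume] 0 := by
  obtain ⟨K, hK⟩ := exists_abs_deriv_smoothStep_le
  choose P hP using fun n => hc.exists_isTransition (hab n) (hp n) (hbound n)
    (hK (a n) (b n) (hab n))
  have hint : Integrable (fun x => ‖u x‖ ^ 2) volume :=
    (memLp_two_iff_integrable_sq_norm hu2.aestronglyMeasurable).1 hu2
  have hb_neg : Tendsto (fun n => b (-n)) atTop atBot := hb.comp tendsto_neg_atTop_atBot
  have ha_neg : Tendsto (fun n => a (-n)) atTop atBot :=
    tendsto_atBot_mono (fun n => (hab (-n)).le) hb_neg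
  have hb_pos : Tendsto b atTop atTop := tendsto_atTop_mono (fun n => (hab n).le) ha
  have hle : ∀ᶠ n in atTop, (c - l) * ∫ x in b (-n)..a n, ‖u x‖ ^ 2 ≤
      C * K ^ 2 * (∫ x in a (-n)..b (-n), ‖u x‖ ^ 2) +
        C * K ^ 2 * ∫ x in a n..b n, ‖u x‖ ^ 2 := by
    filter_upwards [hb_neg.eventually_lt_atBot 0, ha.eventually_gt_atTop 0] with n hbn han
    exact (hP (-n)).mul_intervalIntegral_le (hP n) (hbn.trans han) hc.p_ne_zero hbelow hl.le hu
  have hlim_bot : Tendsto (fun x => ∫ t in (0 : ℝ)..x, ‖u t‖ ^ 2) atBot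
      (𝓝 (-∫ t in Set.Iic 0, ‖u t‖ ^ 2)) :=
    (intervalIntegral_tendsto_integral_Iic 0 hint.integrableOn tendsto_id).neg.congr
      fun x => (intervalIntegral.integral_symm _ _).symm
  have hlim_top := intervalIntegral_tendsto_integral_Ioi 0 hint.integrableOn tendsto_id
  have hlim := le_of_tendsto_of_tendsto
    ((intervalIntegral_tendsto_integral hint hb_neg ha).const_mul (c - l))
    (((tendsto_intervalIntegral_zero hint.locallyIntegrable hlim_bot ha_neg hb_neg).const_mul
      (C * K ^ 2)).add ((tendsto_intervalIntegral_zero hint.locallyIntegrable hlim_top ha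
      hb_pos).const_mul (C * K ^ 2))) hle
  simp only [mul_zero, add_zero] at hlim
  have hzero : ∫ x, ‖u x‖ ^ 2 = 0 :=
    le_antisymm (nonpos_of_mul_nonpos_right hlim (sub_pos.2 hl))
      (integral_nonneg fun x => sq_nonneg _)
  rw [integral_eq_zero_iff_of_nonneg (fun x => sq_nonneg _) hint] at hzero
  filter_upwards [hzero] with x hx
  simpa using hx

theorem Admissible.eq_zero_of_smul_mem_maxGraph (hc : Admissible p Q r s)
    (hbelow : ∀ w ∈ (preminOp p Q r s).graph, c * ‖w.1‖ ^ 2 ≤ (⟪w.1, w.2⟫_ℂ).re)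
    {a b : ℤ → ℝ} (hab : ∀ n, a n < b n) (hb : Tendsto b atBot atBot) (ha : Tendsto a atTop atTop)
    (hp : ∀ n, MemW12 p (a n) (b n))
    (hbound : ∀ n, ∀ᵐ x : ℝ, x ∈ Set.Icc (a n) (b n) → |p x| ≤ C * (b n - a n) ^ 2)
    (hl : l < c) {f : L2} (hf : (f, (l : ℂ) • f) ∈ maxGraph p Q r s) : f = 0 := by
  obtain ⟨u, v, hfu, hu⟩ := exists_isQuasiSolution_of_mem_maxGraph hf
  have hu0 := hc.ae_eq_zero_of_eigenfunction hbelow hab hb ha hp hbound hl hu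
    ((Lp.memLp f).ae_eq hfu)
  exact Lp.ext ((hfu.trans hu0).trans (Lp.coeFn_zero _ _ _).symm)

end Eigenfunction

/-! ### Essential self-adjointness -/

section Hilbert

variable {𝕜 H : Type*} [RCLike 𝕜] [NormedAddCommGroup H] [InnerProductSpace 𝕜 H]

theorem mul_norm_le_norm_sub_smul {c l : ℝ} {x y : H}
    (hbelow : c * ‖x‖ ^ 2 ≤ RCLike.re ⟪x, y⟫_𝕜) : (c - l) * ‖x‖ ≤ ‖y - (l : 𝕜) • x‖ := by
  rcases (norm_nonneg x).eq_or_lt with hx | hx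
  · rw [← hx, mul_zero]
    exact norm_nonneg _
  refine le_of_mul_le_mul_left ?_ hx
  calc ‖x‖ * ((c - l) * ‖x‖) = c * ‖x‖ ^ 2 - l * ‖x‖ ^ 2 := by ring
    _ ≤ RCLike.re ⟪x, y⟫_𝕜 - l * ‖x‖ ^ 2 := sub_le_sub_right hbelow _
    _ = RCLike.re ⟪x, y - (l : 𝕜) • x⟫_𝕜 := by
        rw [inner_sub_right, inner_smul_right, map_sub, RCLike.re_ofReal_mul,
          inner_self_eq_norm_sq]
    _ ≤ ‖x‖ * ‖y - (l : 𝕜) • x‖ := re_inner_le_norm _ _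

theorem exists_mem_sub_smul_eq [CompleteSpace H] {G : Submodule 𝕜 (H × H)}
    (hG : IsClosed (G : Set (H × H))) {δ : ℝ} (hδ : 0 < δ) {l : 𝕜}
    (hbound : ∀ w ∈ G, δ * ‖w.1‖ ≤ ‖w.2 - l • w.1‖)
    (horth : ∀ y, (∀ w ∈ G, ⟪w.2 - l • w.1, y⟫_𝕜 = 0) → y = 0) (y : H) :
    ∃ w ∈ G, w.2 - l • w.1 = y := by
  let A : G →L[𝕜] H :=
    (ContinuousLinearMap.snd 𝕜 H H - l • ContinuousLinearMap.fst 𝕜 H H) ∘L G.subtypeL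
  have hA (w : G) : A w = w.1.2 - l • w.1.1 := rfl
  have hfst (w : G) : ‖w.1.1‖ ≤ δ⁻¹ * ‖A w‖ := by
    rw [inv_mul_eq_div, le_div_iff₀' hδ]
    exact hbound w w.2
  have hnorm (w : G) : ‖w‖ ≤ (δ⁻¹ + (1 + ‖l‖ * δ⁻¹)) * ‖A w‖ := by
    have hsnd : ‖w.1.2‖ ≤ ‖A w‖ + ‖l‖ * ‖w.1.1‖ := by
      rw [← norm_smul, hA]
      exact norm_le_norm_sub_add _ _
    calc ‖w‖ ≤ ‖w.1.1‖ + ‖w.1.2‖ :=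
          max_le_add_of_nonneg (norm_nonneg _) (norm_nonneg _)
      _ ≤ δ⁻¹ * ‖A w‖ + (‖A w‖ + ‖l‖ * (δ⁻¹ * ‖A w‖)) := by
          gcongr
          · exact hfst w
          · exact hsnd.trans (by gcongr; exact hfst w)
      _ = _ := by ring
  have hanti : AntilipschitzWith (δ⁻¹ + (1 + ‖l‖ * δ⁻¹)).toNNReal A :=
    A.antilipschitz_of_bound fun w => by
      rw [Real.coe_toNNReal _ (by positivity)]
      exact hnorm w
  have : CompleteSpace G := hG.completeSpace_coe
  have hclosed : IsClosed (A.range : Set H) := hanti.isClosed_range A.uniformContinuous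
  have hdense : A.rangeᗮ = ⊥ := (Submodule.eq_bot_iff _).2 fun z hz => horth z fun w hw =>
    (Submodule.mem_orthogonal _ _).1 hz _ ⟨⟨w, hw⟩, rfl⟩
  have htop : A.range = ⊤ := by
    rw [← hclosed.submodule_topologicalClosure_eq, Submodule.topologicalClosure_eq_top_iff, hdense]
  obtain ⟨w, hw⟩ := htop.ge (Submodule.mem_top (x := y))
  exact ⟨w, w.2, hw⟩

theorem adjoint_topologicalClosure (G : Submodule 𝕜 (H × H)) :
    G.topologicalClosure.adjoint = G.adjoint := by
  ext f
  rw [Submodule.mem_adjoint_iff, Submodule.mem_adjoint_iff]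
  refine ⟨fun h a b hab => h a b (G.le_topologicalClosure hab), fun h a b hab => ?_⟩
  have hcl : IsClosed {w : H × H | ⟪w.2, f.1⟫_𝕜 - ⟪w.1, f.2⟫_𝕜 = 0} :=
    isClosed_eq (by fun_prop) continuous_const
  exact closure_minimal (fun w hw => h w.1 w.2 hw) hcl hab

variable [CompleteSpace H] {T : H →ₗ.[𝕜] H} {c l : ℝ}

theorem topologicalClosure_graph_eq_adjoint_graph (hT : Dense (T.domain : Set H)) (hle : T ≤ T†)
    (hbelow : ∀ w ∈ T.graph, c * ‖w.1‖ ^ 2 ≤ RCLike.re ⟪w.1, w.2⟫_𝕜) (hl : l < c)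
    (hker : ∀ f, (f, (l : 𝕜) • f) ∈ T†.graph → f = 0) :
    T.graph.topologicalClosure = T†.graph := by
  have hcl : T.graph.topologicalClosure ≤ T†.graph :=
    Submodule.topologicalClosure_minimal _ (LinearPMap.le_graph_of_le hle)
      (LinearPMap.adjoint_isClosed hT)
  have hbound : ∀ w ∈ T.graph.topologicalClosure, (c - l) * ‖w.1‖ ≤ ‖w.2 - (l : 𝕜) • w.1‖ :=
    fun w hw => closure_minimal (t := {w : H × H | (c - l) * ‖w.1‖ ≤ ‖w.2 - (l : 𝕜) • w.1‖})
      (fun w hw => mul_norm_le_norm_sub_smul (hbelow w hw))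
      (isClosed_le (by fun_prop) (by fun_prop)) hw
  have horth (y : H)
      (hy : ∀ w ∈ T.graph.topologicalClosure, ⟪w.2 - (l : 𝕜) • w.1, y⟫_𝕜 = 0) : y = 0 := by
    refine hker y ?_
    rw [LinearPMap.adjoint_graph_eq_graph_adjoint hT, Submodule.mem_adjoint_iff]
    intro a b hab
    rw [inner_smul_right, ← RCLike.conj_ofReal, ← inner_smul_left, ← inner_sub_left]
    exact hy (a, b) (T.graph.le_topologicalClosure hab)
  refine le_antisymm hcl ?_
  rintro ⟨f, g⟩ hfg
  obtain ⟨w, hw, hwfg⟩ := exists_mem_sub_smul_eq T.graph.isClosed_topologicalClosure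
    (sub_pos.2 hl) hbound horth (g - (l : 𝕜) • f)
  have hsnd : g - w.2 = (l : 𝕜) • (f - w.1) := by
    rw [smul_sub, sub_eq_sub_iff_sub_eq_sub, hwfg]
  have hfst : f - w.1 = 0 := hker _ (hsnd ▸ T†.graph.sub_mem hfg (hcl hw))
  have hwf : w = (f, g) := by
    rw [hfst, smul_zero] at hsnd
    exact Prod.ext (sub_eq_zero.1 hfst).symm (sub_eq_zero.1 hsnd).symm
  exact hwf ▸ hw

theorem isClosable_of_le_adjoint (hT : Dense (T.domain : Set H)) (hle : T ≤ T†) : T.IsClosable :=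
  (LinearPMap.adjoint_isClosed hT).isClosable.leIsClosable hle

theorem closure_eq_adjoint (hT : Dense (T.domain : Set H)) (hle : T ≤ T†)
    (hbelow : ∀ w ∈ T.graph, c * ‖w.1‖ ^ 2 ≤ RCLike.re ⟪w.1, w.2⟫_𝕜) (hl : l < c)
    (hker : ∀ f, (f, (l : 𝕜) • f) ∈ T†.graph → f = 0) : T.closure = T† :=
  LinearPMap.eq_of_eq_graph <|
    (isClosable_of_le_adjoint hT hle).graph_closure_eq_closure_graph.symm.trans
      (topologicalClosure_graph_eq_adjoint_graph hT hle hbelow hl hker)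

theorem isSelfAdjoint_adjoint_of_closure_eq (hT : Dense (T.domain : Set H))
    (hle : T ≤ T†) (hclosure : T.closure = T†) : IsSelfAdjoint T† := by
  have hgraph : T.graph.topologicalClosure = T†.graph := by
    rw [(isClosable_of_le_adjoint hT hle).graph_closure_eq_closure_graph, hclosure]
  refine LinearPMap.isSelfAdjoint_def.2 (LinearPMap.eq_of_eq_graph ?_)
  rw [LinearPMap.adjoint_graph_eq_graph_adjoint (hT.mono hle.1), ← hgraph,
    adjoint_topologicalClosure, ← LinearPMap.adjoint_graph_eq_graph_adjoint hT, hgraph]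

end Hilbert

theorem preminOp_le_maxOp : preminOp p Q r s ≤ maxOp p Q r s :=
  LinearPMap.domRestrict_le

theorem BoundedBelow.exists_forall_mem_graph {T : L2 →ₗ.[ℂ] L2} (hT : BoundedBelow T) :
    ∃ c : ℝ, ∀ w ∈ T.graph, c * ‖w.1‖ ^ 2 ≤ (⟪w.1, w.2⟫_ℂ).re := by
  obtain ⟨c, hc⟩ := hT
  refine ⟨c, fun w hw => ?_⟩
  obtain ⟨y, hy, hyw⟩ := (LinearPMap.mem_graph_iff _).1 hw
  rw [← hy, ← hyw]
  exact hc y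

end SturmLiouville

end

theorem theorem2 (p Q r s : ℝ → ℝ) (hcoef : SturmLiouville.Admissible p Q r s)
    (hbelow : SturmLiouville.BoundedBelow (SturmLiouville.preminOp p Q r s))
    (a b : ℤ → ℝ) (hab : ∀ n, a n < b n)
    (hb : Tendsto b atBot atBot) (ha : Tendsto a atTop atTop)
    (hp : ∀ n, SturmLiouville.MemW12 p (a n) (b n))
    (hpos : ∀ n, ∀ᵐ x : ℝ, x ∈ Set.Icc (a n) (b n) → 0 < p x)
    (hbound : ∃ C : ℝ, 0 < C ∧
      ∀ n, ∀ᵐ x : ℝ, x ∈ Set.Icc (a n) (b n) → p x ≤ C * (b n - a n) ^ 2) :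
    SturmLiouville.EssentiallySelfAdjoint (SturmLiouville.preminOp p Q r s) ∧
      (SturmLiouville.preminOp p Q r s)† = SturmLiouville.maxOp p Q r s ∧
      SturmLiouville.maxOp p Q r s = (SturmLiouville.maxOp p Q r s)† := by
  obtain ⟨C, -, hbound⟩ := hbound
  obtain ⟨c, hc⟩ := hbelow.exists_forall_mem_graph
  have habs : ∀ n, ∀ᵐ x : ℝ, x ∈ Set.Icc (a n) (b n) → |p x| ≤ C * (b n - a n) ^ 2 := fun n => by
    filter_upwards [hpos n, hbound n] with x hx hxC hxI
    rw [abs_of_pos (hx hxI)]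
    exact hxC hxI
  have hdense := hcoef.dense_domain_preminOp
  have hadj := hcoef.adjoint_preminOp
  have hle : SturmLiouville.preminOp p Q r s ≤ (SturmLiouville.preminOp p Q r s)† :=
    hadj ▸ SturmLiouville.preminOp_le_maxOp
  have hclosure := SturmLiouville.closure_eq_adjoint hdense hle hc (sub_one_lt c) fun f hf => by
    rw [hadj, SturmLiouville.graph_maxOp] at hf
    exact hcoef.eq_zero_of_smul_mem_maxGraph hc hab hb ha hp habs (sub_one_lt c) hf
  have hself := SturmLiouville.isSelfAdjoint_adjoint_of_closure_eq hdense hle hclosure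
  exact ⟨⟨hdense, SturmLiouville.isClosable_of_le_adjoint hdense hle, hclosure ▸ hself⟩, hadj,
    hadj ▸ (LinearPMap.isSelfAdjoint_def.1 hself).symm⟩
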